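/- Theorem. Let $\mathbb A=(A;\to)$ be a digraph (a set, finite or infinite, of any cardinality, with a binary relation) which is smooth, i.e. every vertex has at least one out-neighbour and at least one in-neighbour. Let $G$ be a subgroup of the automorphism group $\operatorname{Aut}(\mathbb A)$ that has only finitely many orbits in its coordinatewise action on $A\times A$. Let $\mathbb A/G$ be the factor digraph: its vertices are the orbits of $G$ on $A$, and there is an edge from $u$ to $v$ iff $a\to b$ for some $a\in u$ and $b\in v$. If $\mathbb A/G$ is symmetric, has no loop, and is not bipartite, then the structure $\mathbb A'$ obtained by expanding $\mathbb A$ by the orbits of $G$ on $A$ (as unary relations) pp-interprets with parameters every finite relational structure. Here a structure $\mathbb C$ with domain $C$ pp-interprets a relational structure $\mathbb B$ with domain $B$ if there are $d\ge 1$ and a partial surjective map $h\colon C^d\to B$ such that for every $n$ and every $R\subseteq B^n$ that is $B$ itself (with $n=1$), the equality relation on $B$, or a relation of $\mathbb B$, the preimage $h^{-1}(R)$, seen as a relation of arity $nd$ on $C$, is definable in $\mathbb C$ by a primitive positive formula (one built from atomic formulas, including equalities, by conjunction and existential quantification). It pp-interprets $\mathbb B$ with parameters if the expansion of $\mathbb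 C$ by all unary relations $\{c\}$, $c\in C$, pp-interprets $\mathbb B$. -/

import Mathlib

universe u v w u₁ v₁ w₁

/-! ### Primitive positive formulas, definability and interpretations -/

namespace FirstOrder.Language

/-- Primitive positive formulas: built from atomic formulas (equalities between terms and relation
symbols applied to terms) by conjunction and existential quantification. -/
inductive BoundedFormula.IsPP {L : Language.{u, v}} {α : Type w} :
    ∀ {n : ℕ}, L.BoundedFormula α n → Prop
  | atomic {n : ℕ} {φ : L.BoundedFormula α n} (h : φ.IsAtomic) : IsPP φ
  | inf {n : ℕ} {φ ψ : L.BoundedFormula α n} (h₁ : IsPP φ) (h₂ : IsPP ψ) : IsPP (φ ⊓ ψ)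
  | ex {n : ℕ} {φ : L.BoundedFormula α (n + 1)} (h : IsPP φ) : IsPP φ.ex

/-- The relation `R` on `A`, with coordinates indexed by `α`, is defined in the `L`-structure `A` by
a primitive positive formula with free variables in `α` (and without parameters). -/
def PPDefinable (L : Language.{u, v}) {A : Type w} [L.Structure A] {α : Type} (R : Set (α → A)) :
    Prop :=
  ∃ φ : L.Formula α, BoundedFormula.IsPP φ ∧ ∀ x : α → A, φ.Realize x ↔ x ∈ R

/-- The preimage of an `n`-ary relation `R` on `B` under a partial map `h : A^d → B`, as a relation
of arity `n * d` on `A`: its coordinates are indexed by `Fin n × Fin d`, the `i`-th block of length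
`d` being a representative of the `i`-th entry. -/
def blockPreimage {A : Type w} {B : Type w₁} {d n : ℕ} (h : (Fin d → A) →. B)
    (R : Set (Fin n → B)) : Set (Fin n × Fin d → A) :=
  {x | ∃ b : Fin n → B, b ∈ R ∧ ∀ i, b i ∈ h fun j => x (i, j)}

/-- The structure `A` pp-interprets the relational structure `B`: there are `d ≥ 1` and a partial
surjective map `h : A^d → B` such that the preimages of `B` (as a unary relation), of the equality
on `B`, and of every relation of `B` are pp-definable in `A`. -/
def PPInterprets (L : Language.{u, v}) (A : Type w) [L.Structure A]
    (L' : Language.{u₁, v₁}) [L'.IsRelational] (B : Type w₁) [L'.Structure B] : Prop :=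
  ∃ d : ℕ, 1 ≤ d ∧ ∃ h : (Fin d → A) →. B,
    (∀ b : B, ∃ x : Fin d → A, b ∈ h x) ∧
    L.PPDefinable (blockPreimage h (Set.univ : Set (Fin 1 → B))) ∧
    L.PPDefinable (blockPreimage h {b : Fin 2 → B | b 0 = b 1}) ∧
    ∀ (n : ℕ) (R : L'.Relations n),
      L.PPDefinable (blockPreimage h {b : Fin n → B | Structure.RelMap R b})

/-- Relation symbols of a language with one unary symbol for each `p : P`. -/
inductive UnaryRel (P : Type u) : ℕ → Type u
  | mk (p : P) : UnaryRel P 1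

/-- The language with one unary relation symbol for each `p : P` and nothing else. -/
def unaryLanguage (P : Type u) : Language.{0, u} := ⟨fun _ => Empty, UnaryRel P⟩

/-- A family of subsets of `A` as a structure with unary relations. -/
@[reducible]
def unaryStructure {P : Type u} {A : Type w} (U : P → Set A) : (unaryLanguage P).Structure A where
  funMap := fun f _ => Empty.elim f
  RelMap := fun R x => match R with
    | .mk p => x 0 ∈ U p

/-- The structure `A` pp-interprets the structure `B` with parameters: the expansion of `A` by
all the unary relations `{a}`, `a ∈ A`, pp-interprets `B`. -/
def PPInterpretsWithParameters (L : Language.{u, v}) (A : Type w) [L.Structure A]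
    (L' : Language.{u₁, v₁}) [L'.IsRelational] (B : Type w₁) [L'.Structure B] : Prop :=
  letI := unaryStructure fun a : A => ({a} : Set A)
  PPInterprets (L.sum (unaryLanguage A)) A L' B

end FirstOrder.Language

/-! ### Digraphs -/

namespace Digraph

/-- A digraph is smooth if every vertex has an out-neighbour and an in-neighbour. -/
def IsSmooth {A : Type u} (D : Digraph A) : Prop :=
  (∀ a, ∃ b, D.Adj a b) ∧ ∀ a, ∃ b, D.Adj b a

/-- A digraph is symmetric if its edge relation is. -/
def IsSymmetric {A : Type u} (D : Digraph A) : Prop := ∀ a b, D.Adj a b → D.Adj b a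

/-- A digraph is loopless if no vertex is adjacent to itself. -/
def IsLoopless {A : Type u} (D : Digraph A) : Prop := ∀ a, ¬ D.Adj a a

/-- A digraph is bipartite if its vertices can be split into two classes such that every edge
joins vertices of different classes. -/
def IsBipartite {A : Type u} (D : Digraph A) : Prop :=
  ∃ S : Set A, ∀ a b, D.Adj a b → (a ∈ S ↔ b ∉ S)

/-- The group of automorphisms of a digraph. -/
abbrev Aut {A : Type u} (D : Digraph A) : Type u := D.Adj ≃r D.Adj

/-- The factor digraph `D / G`: its vertices are the orbits of `G` on the vertices of `D`, and there
is an edge from `u` to `v` iff `D` has an edge from some element of `u` to some element of `v`. -/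
def factor {A : Type u} (D : Digraph A) (G : Subgroup D.Aut) :
    Digraph (MulAction.orbitRel.Quotient G A) where
  Adj := fun o o' => ∃ a b : A, a ∈ o.orbit ∧ b ∈ o'.orbit ∧ D.Adj a b

/-- A digraph as a structure with a single binary relation. -/
@[reducible]
def toStructure {A : Type u} (D : Digraph A) : FirstOrder.Language.graph.Structure A where
  funMap := fun f _ => Empty.elim f
  RelMap := fun R x => match R with
    | .adj => D.Adj (x 0) (x 1)

/-- The language with a binary relation symbol and a unary relation symbol for each orbit
of `G`. -/
abbrev orbitLanguage {A : Type u} (D : Digraph A) (G : Subgroup D.Aut) : FirstOrder.Language.{0, u} :=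
  FirstOrder.Language.graph.sum (FirstOrder.Language.unaryLanguage (MulAction.orbitRel.Quotient G A))

/-- The expansion of the digraph `D` by the orbits of `G` on its vertices, as unary relations. -/
@[reducible]
def orbitExpansion {A : Type u} (D : Digraph A) (G : Subgroup D.Aut) :
    (D.orbitLanguage G).Structure A :=
  letI := D.toStructure
  letI := FirstOrder.Language.unaryStructure fun o : MulAction.orbitRel.Quotient G A => o.orbit
  inferInstance

end Digraph

/-! Only closure under pp-definitions with parameters matters, so the argument runs in an abstract
`RelClone`. It suffices that the clone is `Hard`, that is, interprets all Boolean relations in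
dimension one: a finite structure is then coded by Boolean tuples (`ppInterprets_of_hard`).

`FactorGraph.hard` is an induction on the number of orbits of `G` on pairs. An odd power of the edge
relation turns a shortest odd closed walk of the factor graph into a triangle without creating
loops. If some proper definable invariant subset is not 2-colourable, or some nontrivial definable
invariant equivalence contains no pair adjacent in the factor graph, one passes to the subset or to
the quotient, which has fewer orbits of pairs. Otherwise the digraph is a `MinimalGraph`.

Minimality acts in two ways: a definable invariant set containing a triangle is everything, and a
definable invariant reflexive symmetric relation disjoint from the factor edges is equality
(`eq_of_avoid`). Relations of the second kind, built from zigzags of edges, show that the factor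
graph has no diamond (`diamond_free`), that it is a single triangle, and that every vertex has
exactly one out-neighbour and one in-neighbour in each other orbit (`exists_coloring`).

The edges are thus given by two permutations commuting with `G`. Finiteness of the orbits on pairs
makes their composite periodic at every point, with period `m ≥ 3`. Alternating `E` and its inverse
`m - 2` times reaches all but one of `m` points, which is the inequality relation (`hard_of_cycle`).
With parameters, inequality yields not-all-equal, and hence every Boolean relation (`hard_of_neq`,
`def_of_nae`). -/

/-! ### Relation clones, interpretations and hardness -/

/-- A family of finitary relations on `A` closed under primitive positive definitions with
parameters. -/
structure RelClone (A : Type u) where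
  Def : ∀ {α : Type} [Finite α], ((α → A) → Prop) → Prop
  true' : ∀ {α : Type} [Finite α], Def fun _ : α → A => True
  and' : ∀ {α : Type} [Finite α] {P Q : (α → A) → Prop}, Def P → Def Q → Def fun x => P x ∧ Q x
  reindex' : ∀ {α β : Type} [Finite α] [Finite β] (f : α → β) {P : (α → A) → Prop},
    Def P → Def fun x : β → A => P fun i => x (f i)
  ex' : ∀ {α : Type} [Finite α] {P : (Option α → A) → Prop},
    Def P → Def fun x : α → A => ∃ a, P fun o => o.elim a x
  eq' : Def fun x : Bool → A => x false = x true
  const' : ∀ a, Def fun x : Unit → A => x () = a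

namespace RelClone

variable {A : Type u} (𝒞 : RelClone A)

/-- Definability of a set. -/
def Def1 (X : Set A) : Prop := 𝒞.Def fun x : Unit → A => x () ∈ X

/-- Definability of a binary relation. -/
def Def2 (R : A → A → Prop) : Prop := 𝒞.Def fun x : Bool → A => R (x false) (x true)

variable {𝒞} {α β : Type} [Finite α] [Finite β]

theorem Def.congr {P Q : (α → A) → Prop} (h : 𝒞.Def P) (hPQ : ∀ x, P x ↔ Q x) : 𝒞.Def Q := by
  have : P = Q := funext fun x => propext (hPQ x)
  exact this ▸ h

theorem Def.and {P Q : (α → A) → Prop} (hP : 𝒞.Def P) (hQ : 𝒞.Def Q) :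
    𝒞.Def fun x => P x ∧ Q x := 𝒞.and' hP hQ

theorem Def.reindex (f : α → β) {P : (α → A) → Prop} (h : 𝒞.Def P) :
    𝒞.Def fun x : β → A => P fun i => x (f i) := 𝒞.reindex' f h

theorem Def.ex {P : (α → A) → A → Prop}
    (h : 𝒞.Def fun x : Option α → A => P (fun i => x (some i)) (x none)) :
    𝒞.Def fun x : α → A => ∃ a, P x a := 𝒞.ex' h

theorem Def.all {ι : Type} [Finite ι] {P : ι → (α → A) → Prop} (h : ∀ i, 𝒞.Def (P i)) :
    𝒞.Def fun x => ∀ i, P i x := by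
  classical
  have := Fintype.ofFinite ι
  suffices H : ∀ s : Finset ι, 𝒞.Def fun x => ∀ i ∈ s, P i x from
    (H Finset.univ).congr fun x => by simp
  intro s
  induction s using Finset.induction_on with
  | empty => exact 𝒞.true'.congr fun x => by simp
  | insert a s _ ih => exact ((h a).and ih).congr fun x => by simp

theorem Def.imp {p : Prop} {P : (α → A) → Prop} (h : p → 𝒞.Def P) : 𝒞.Def fun x => p → P x := by
  by_cases hp : p
  · exact (h hp).congr fun x => by simp [hp]
  · exact 𝒞.true'.congr fun x => by simp [hp]

theorem Def1.app {X : Set A} (h : 𝒞.Def1 X) (i : α) : 𝒞.Def fun x : α → A => x i ∈ X :=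
  𝒞.reindex' (fun _ => i) h

theorem Def2.app {R : A → A → Prop} (h : 𝒞.Def2 R) (i j : α) :
    𝒞.Def fun x : α → A => R (x i) (x j) :=
  𝒞.reindex' (fun b : Bool => bif b then j else i) h

theorem def2_eq : 𝒞.Def2 fun a b => a = b := 𝒞.eq'

theorem def1_singleton (a : A) : 𝒞.Def1 {a} := 𝒞.const' a

theorem Def1.inter {X Y : Set A} (hX : 𝒞.Def1 X) (hY : 𝒞.Def1 Y) : 𝒞.Def1 (X ∩ Y) :=
  Def.and hX hY

theorem def1_univ : 𝒞.Def1 Set.univ := 𝒞.true'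

theorem Def2.and {R S : A → A → Prop} (hR : 𝒞.Def2 R) (hS : 𝒞.Def2 S) :
    𝒞.Def2 fun a b => R a b ∧ S a b := Def.and hR hS

theorem Def2.flip {R : A → A → Prop} (hR : 𝒞.Def2 R) : 𝒞.Def2 fun a b => R b a :=
  hR.app true false

theorem Def2.comp {R S : A → A → Prop} (hR : 𝒞.Def2 R) (hS : 𝒞.Def2 S) :
    𝒞.Def2 (Relation.Comp R S) :=
  Def.ex (P := fun x b => R (x false) b ∧ S b (x true))
    ((hR.app _ _).and (hS.app _ _))

theorem Def2.image {R : A → A → Prop} (hR : 𝒞.Def2 R) {X : Set A} (hX : 𝒞.Def1 X) :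
    𝒞.Def1 {b | ∃ a ∈ X, R a b} :=
  Def.ex (P := fun x b => b ∈ X ∧ R b (x ())) ((hX.app _).and (hR.app _ _))

theorem Def2.diag {R : A → A → Prop} (hR : 𝒞.Def2 R) : 𝒞.Def1 {a | R a a} :=
  hR.app () ()

theorem Def2.left {R : A → A → Prop} (hR : 𝒞.Def2 R) (a : A) : 𝒞.Def1 {b | R a b} := by
  refine (hR.image (def1_singleton a)).congr fun x => ?_
  simp

theorem def1_sInter {F : Set (Set A)} (hF : F.Finite) (h : ∀ X ∈ F, 𝒞.Def1 X) :
    𝒞.Def1 (⋂₀ F) := by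
  induction F, hF using Set.Finite.induction_on with
  | empty => simpa using def1_univ
  | @insert X F _ _ ih =>
    rw [Set.sInter_insert]
    exact (h _ (Set.mem_insert _ _)).inter (ih fun Y hY => h Y (Set.mem_insert_of_mem _ hY))

theorem def2_sInter {F : Set (Set (A × A))} (hF : F.Finite)
    (h : ∀ X ∈ F, 𝒞.Def2 fun a b => (a, b) ∈ X) : 𝒞.Def2 fun a b => (a, b) ∈ ⋂₀ F := by
  induction F, hF using Set.Finite.induction_on with
  | empty => exact 𝒞.true'.congr (by simp)
  | @insert X F _ _ ih =>
    rw [Set.sInter_insert]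
    exact (h _ (Set.mem_insert _ _)).and (ih fun Y hY => h Y (Set.mem_insert_of_mem _ hY))

/-- A partial surjective map from `A` onto `B`, given as a relation, whose domain and kernel are
definable. -/
structure IsInterp (𝒞 : RelClone A) {B : Type v} (h : A → B → Prop) : Prop where
  func : ∀ {a b b'}, h a b → h a b' → b = b'
  surj : ∀ b, ∃ a, h a b
  dom : 𝒞.Def1 {a | ∃ b, h a b}
  ker : 𝒞.Def2 fun a a' => ∃ b, h a b ∧ h a' b

/-- The relations on `B` whose preimages are definable. -/
def interp (𝒞 : RelClone A) {B : Type v} {h : A → B → Prop} (H : 𝒞.IsInterp h) : RelClone B where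
  Def P := 𝒞.Def fun x => ∃ y : _ → B, (∀ i, h (x i) (y i)) ∧ P y
  true' {α _} := by
    refine (Def.all fun i : α => H.dom.app i).congr fun x => ?_
    constructor
    · intro hx
      choose y hy using hx
      exact ⟨y, hy, trivial⟩
    · rintro ⟨y, hy, -⟩ i
      exact ⟨y i, hy i⟩
  and' {α _ P Q} hP hQ := by
    refine (Def.and hP hQ).congr fun x => ?_
    constructor
    · rintro ⟨⟨y, hy, hyP⟩, z, hz, hzQ⟩
      obtain rfl : y = z := funext fun i => H.func (hy i) (hz i)
      exact ⟨y, hy, hyP, hzQ⟩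
    · rintro ⟨y, hy, hyP, hyQ⟩
      exact ⟨⟨y, hy, hyP⟩, y, hy, hyQ⟩
  reindex' {α β _ _} f P hP := by
    refine (Def.and (Def.all fun i : β => H.dom.app i) (Def.reindex f hP)).congr fun x => ?_
    constructor
    · rintro ⟨hx, z, hz, hzP⟩
      choose y hy using hx
      obtain rfl : z = fun i => y (f i) := funext fun i => H.func (hz i) (hy (f i))
      exact ⟨y, hy, hzP⟩
    · rintro ⟨y, hy, hyP⟩
      exact ⟨fun i => ⟨y i, hy i⟩, _, fun i => hy (f i), hyP⟩
  ex' {α _ P} hP := by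
    refine (𝒞.ex' hP).congr fun x => ?_
    constructor
    · rintro ⟨a, y, hy, hyP⟩
      refine ⟨fun i => y (some i), fun i => hy (some i), y none, ?_⟩
      convert hyP using 1
      funext o
      cases o <;> rfl
    · rintro ⟨y, hy, b, hyP⟩
      obtain ⟨a, ha⟩ := H.surj b
      exact ⟨a, _, fun o => by cases o; exacts [ha, hy _], hyP⟩
  eq' := by
    refine H.ker.congr fun x => ?_
    constructor
    · rintro ⟨b, h1, h2⟩
      exact ⟨fun _ => b, by rintro (_ | _) <;> assumption, rfl⟩
    · rintro ⟨y, hy, hyy⟩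
      exact ⟨y false, hy _, hyy ▸ hy _⟩
  const' b := by
    obtain ⟨a, ha⟩ := H.surj b
    refine (H.ker.left a).congr fun x => ?_
    constructor
    · rintro ⟨c, h1, h2⟩
      exact ⟨fun _ => c, fun _ => h2, H.func h1 ha⟩
    · rintro ⟨y, hy, rfl⟩
      exact ⟨y (), ha, hy ()⟩

theorem interp_def1 {B : Type v} {h : A → B → Prop} (H : 𝒞.IsInterp h) {X : Set B} :
    (𝒞.interp H).Def1 X ↔ 𝒞.Def1 {a | ∃ b, h a b ∧ b ∈ X} := by
  have : ∀ x : Unit → A, (∃ y : Unit → B, (∀ i, h (x i) (y i)) ∧ y () ∈ X) ↔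
      ∃ b, h (x ()) b ∧ b ∈ X := fun x =>
    ⟨fun ⟨y, h1, h2⟩ => ⟨_, h1 (), h2⟩, fun ⟨b, h1, h2⟩ => ⟨fun _ => b, fun _ => h1, h2⟩⟩
  exact ⟨fun h => Def.congr (𝒞 := 𝒞) h this,
    fun h => (Def.congr (𝒞 := 𝒞) h fun x => (this x).symm :)⟩

theorem interp_def2 {B : Type v} {h : A → B → Prop} (H : 𝒞.IsInterp h) {R : B → B → Prop} :
    (𝒞.interp H).Def2 R ↔ 𝒞.Def2 fun a a' => ∃ b b', h a b ∧ h a' b' ∧ R b b' := by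
  have : ∀ x : Bool → A,
      (∃ y : Bool → B, (∀ i, h (x i) (y i)) ∧ R (y false) (y true)) ↔
      ∃ b b', h (x false) b ∧ h (x true) b' ∧ R b b' := fun x =>
    ⟨fun ⟨y, h1, h2⟩ => ⟨_, _, h1 _, h1 _, h2⟩, fun ⟨b, b', h1, h2, h3⟩ =>
      ⟨fun i => bif i then b' else b, by rintro (_ | _) <;> assumption, h3⟩⟩
  exact ⟨fun h => Def.congr (𝒞 := 𝒞) h this,
    fun h => (Def.congr (𝒞 := 𝒞) h fun x => (this x).symm :)⟩

/-- The relations of the clone interpret all relations on the Booleans. -/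
def Hard (𝒞 : RelClone A) : Prop :=
  ∃ h : A → Bool → Prop, (∀ {a b b'}, h a b → h a b' → b = b') ∧ (∀ b, ∃ a, h a b) ∧
    ∀ {α : Type} [Finite α] (P : (α → Bool) → Prop),
      𝒞.Def fun x : α → A => ∃ y, (∀ i, h (x i) (y i)) ∧ P y

theorem Hard.of_interp {B : Type v} {h : A → B → Prop} {H : 𝒞.IsInterp h}
    (hh : (𝒞.interp H).Hard) : 𝒞.Hard := by
  obtain ⟨k, k1, k2, k3⟩ := hh
  refine ⟨fun a c => ∃ b, h a b ∧ k b c, ?_, ?_, ?_⟩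
  · rintro a c c' ⟨b, h1, h2⟩ ⟨b', h1', h2'⟩
    obtain rfl := H.func h1 h1'
    exact k1 h2 h2'
  · intro c
    obtain ⟨b, hb⟩ := k2 c
    obtain ⟨a, ha⟩ := H.surj b
    exact ⟨a, b, ha, hb⟩
  · intro α _ P
    refine Def.congr (k3 P) fun x => ?_
    constructor
    · rintro ⟨y, hy, z, hz, hP⟩
      exact ⟨z, fun i => ⟨y i, hy i, hz i⟩, hP⟩
    · rintro ⟨z, hz, hP⟩
      choose y hy using hz
      exact ⟨y, fun i => (hy i).1, z, fun i => (hy i).2, hP⟩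

end RelClone

/-! ### Invariant sets and relations, and the factor graph on points -/

section Invariant

variable (G : Type v) [Group G] {A : Type u} [MulAction G A]

/-- Invariance of a set under a group action. -/
def Inv1 (X : Set A) : Prop := ∀ (g : G) {a}, a ∈ X → g • a ∈ X

/-- Invariance of a binary relation under a group action. -/
def Inv2 (R : A → A → Prop) : Prop := ∀ (g : G) {a b}, R a b → R (g • a) (g • b)

/-- The relation that `R` induces between orbits, seen as a relation between points. -/
def Fac (R : A → A → Prop) (a b : A) : Prop := ∃ g : G, R a (g • b)

variable {G}

theorem Inv1.smul_iff {X : Set A} (h : Inv1 G X) (g : G) {a : A} : g • a ∈ X ↔ a ∈ X :=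
  ⟨fun ha => by simpa using h g⁻¹ ha, h g⟩

theorem inv1_orbit (a : A) : Inv1 G (MulAction.orbit G a) := by
  rintro g _ ⟨k, rfl⟩
  exact ⟨g * k, mul_smul g k a⟩

theorem Inv2.and {R S : A → A → Prop} (hR : Inv2 G R) (hS : Inv2 G S) :
    Inv2 G fun a b => R a b ∧ S a b := fun g _ _ h => ⟨hR g h.1, hS g h.2⟩

theorem Inv2.flip {R : A → A → Prop} (hR : Inv2 G R) : Inv2 G fun a b => R b a :=
  fun g _ _ h => hR g h

theorem Inv2.comp {R S : A → A → Prop} (hR : Inv2 G R) (hS : Inv2 G S) :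
    Inv2 G (Relation.Comp R S) := by
  rintro g a b ⟨c, h1, h2⟩
  exact ⟨g • c, hR g h1, hS g h2⟩

theorem Inv2.image {R : A → A → Prop} (hR : Inv2 G R) {X : Set A} (hX : Inv1 G X) :
    Inv1 G {b | ∃ a ∈ X, R a b} := by
  rintro g b ⟨a, ha, h⟩
  exact ⟨g • a, hX g ha, hR g h⟩

theorem Inv2.diag {R : A → A → Prop} (hR : Inv2 G R) : Inv1 G {a | R a a} := fun g _ h => hR g h

theorem Inv2.reflTransGen {R : A → A → Prop} (hR : Inv2 G R) :
    Inv2 G (Relation.ReflTransGen R) := by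
  intro g a b h
  induction h with
  | refl => exact .refl
  | tail _ h ih => exact ih.tail (hR g h)

theorem Fac.of {R : A → A → Prop} {a b : A} (h : R a b) : Fac G R a b := ⟨1, by simpa using h⟩

theorem fac_smul_right {R : A → A → Prop} (g : G) {a b : A} :
    Fac G R a (g • b) ↔ Fac G R a b := by
  constructor
  · rintro ⟨k, h⟩
    exact ⟨k * g, by rwa [mul_smul]⟩
  · rintro ⟨k, h⟩
    exact ⟨k * g⁻¹, by simpa [mul_smul] using h⟩

theorem fac_smul_left {R : A → A → Prop} (hR : Inv2 G R) (g : G) {a b : A} :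
    Fac G R (g • a) b ↔ Fac G R a b := by
  constructor
  · rintro ⟨k, h⟩
    exact ⟨g⁻¹ * k, by simpa [mul_smul] using hR g⁻¹ h⟩
  · rintro ⟨k, h⟩
    exact ⟨g * k, by simpa [mul_smul] using hR g h⟩

theorem fac_orbit_right {R : A → A → Prop} {a b b' : A} (hb : b' ∈ MulAction.orbit G b) :
    Fac G R a b' ↔ Fac G R a b := by
  obtain ⟨g, rfl⟩ := hb
  exact fac_smul_right g

theorem fac_orbit_left {R : A → A → Prop} (hR : Inv2 G R) {a a' b : A}
    (ha : a' ∈ MulAction.orbit G a) : Fac G R a' b ↔ Fac G R a b := by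
  obtain ⟨g, rfl⟩ := ha
  exact fac_smul_left hR g

/-- An invariant set is determined by the orbits it contains. Applied to `A × A`, this leaves only
finitely many invariant binary relations, so chains of them stabilise and intersections are finite.
-/
theorem finite_inv1 [Finite (MulAction.orbitRel.Quotient G A)] :
    {X : Set A | Inv1 G X}.Finite := by
  rw [← Set.finite_coe_iff]
  refine Finite.of_injective (β := Set (MulAction.orbitRel.Quotient G A))
    (fun X => (Quotient.mk _) '' X.1) ?_
  have key : ∀ X Y : {X : Set A | Inv1 G X},
      (Quotient.mk (MulAction.orbitRel G A)) '' X.1 = Quotient.mk _ '' Y.1 → X.1 ⊆ Y.1 := by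
    intro X Y h a ha
    obtain ⟨b, hb, hab⟩ : Quotient.mk _ a ∈ Quotient.mk (MulAction.orbitRel G A) '' Y.1 :=
      h ▸ ⟨a, ha, rfl⟩
    have hab' := Quotient.exact hab
    obtain ⟨g, hg⟩ := hab'
    exact (Inv1.smul_iff Y.2 g).1 (by simpa only [← hg] using hb)
  intro X Y h
  exact Subtype.ext (Set.Subset.antisymm (key X Y h) (key Y X h.symm))

theorem finite_orbits_of_pairs [Finite (MulAction.orbitRel.Quotient G (A × A))] :
    Finite (MulAction.orbitRel.Quotient G A) := by
  refine Finite.of_surjective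
    (Quotient.map' (s₁ := MulAction.orbitRel G (A × A)) (s₂ := MulAction.orbitRel G A)
      Prod.fst ?_) ?_
  · rintro a b ⟨g, rfl⟩
    exact ⟨g, rfl⟩
  · rintro ⟨a⟩
    exact ⟨Quotient.mk'' (a, a), rfl⟩

end Invariant

/-! ### Powers of relations and definability of transitive closures -/

section Powers

variable {A : Type u}

/-- The `n`-fold composition of a relation with itself. -/
def relPow (R : A → A → Prop) : ℕ → A → A → Prop
  | 0 => fun a b => a = b
  | n + 1 => Relation.Comp (relPow R n) R

theorem relPow_add {R : A → A → Prop} {m n : ℕ} {a b : A} :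
    relPow R (m + n) a b ↔ ∃ c, relPow R m a c ∧ relPow R n c b := by
  induction n generalizing b with
  | zero => simp [relPow]
  | succ n ih =>
    constructor
    · rintro ⟨d, h1, h2⟩
      obtain ⟨c, hc, hd⟩ := ih.1 h1
      exact ⟨c, hc, d, hd, h2⟩
    · rintro ⟨c, hc, d, hd, h2⟩
      exact ⟨d, ih.2 ⟨c, hc, hd⟩, h2⟩

theorem relPow_one {R : A → A → Prop} {a b : A} : relPow R 1 a b ↔ R a b := by
  simp [relPow, Relation.Comp]

theorem relPow_mono {R : A → A → Prop} (hR : ∀ a, R a a) {m n : ℕ} (h : m ≤ n) {a b : A}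
    (hab : relPow R m a b) : relPow R n a b := by
  induction h with
  | refl => exact hab
  | step _ ih => exact ⟨b, ih, hR b⟩

theorem relPow_symm {R : A → A → Prop} (hR : ∀ a b, R a b → R b a) {n : ℕ} {a b : A}
    (hab : relPow R n a b) : relPow R n b a := by
  induction n generalizing b with
  | zero => exact hab.symm
  | succ n ih =>
    obtain ⟨c, h1, h2⟩ := hab
    rw [add_comm, relPow_add]
    exact ⟨c, relPow_one.2 (hR _ _ h2), ih h1⟩

theorem reflTransGen_iff_relPow {R : A → A → Prop} {a b : A} :
    Relation.ReflTransGen R a b ↔ ∃ n, relPow R n a b := by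
  constructor
  · intro h
    induction h with
    | refl => exact ⟨0, rfl⟩
    | tail _ h ih =>
      obtain ⟨n, hn⟩ := ih
      exact ⟨n + 1, _, hn, h⟩
  · rintro ⟨n, h⟩
    induction n generalizing b with
    | zero => exact h ▸ .refl
    | succ n ih =>
      obtain ⟨c, h1, h2⟩ := h
      exact (ih h1).tail h2

theorem reflTransGen_symm {R : A → A → Prop} (hR : ∀ a b, R a b → R b a) {a b : A}
    (h : Relation.ReflTransGen R a b) : Relation.ReflTransGen R b a := by
  obtain ⟨n, hn⟩ := reflTransGen_iff_relPow.1 h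
  exact reflTransGen_iff_relPow.2 ⟨n, relPow_symm hR hn⟩

theorem relPow_def {𝒞 : RelClone A} {R : A → A → Prop} (hR : 𝒞.Def2 R) (n : ℕ) :
    𝒞.Def2 (relPow R n) := by
  induction n with
  | zero => exact RelClone.def2_eq
  | succ n ih => exact ih.comp hR

theorem relPow_inv {G : Type v} [Group G] [MulAction G A] {R : A → A → Prop} (hR : Inv2 G R)
    (n : ℕ) : Inv2 G (relPow R n) := by
  induction n with
  | zero => rintro g a b rfl; rfl
  | succ n ih => exact ih.comp hR

/-- The powers of a reflexive relation increase, and there are finitely many invariant relations, so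
the closure is one of the powers. -/
theorem reflTransGen_def {G : Type v} [Group G] [MulAction G A]
    [Finite (MulAction.orbitRel.Quotient G (A × A))] {𝒞 : RelClone A} {R : A → A → Prop}
    (hR : 𝒞.Def2 R) (hinv : Inv2 G R) (hrefl : ∀ a, R a a) :
    𝒞.Def2 (Relation.ReflTransGen R) := by
  let P : ℕ → {X : Set (A × A) | Inv1 G X} := fun n =>
    ⟨{p | relPow R n p.1 p.2}, fun g p hp => relPow_inv hinv n g hp⟩
  have hfin : Finite {X : Set (A × A) | Inv1 G X} := finite_inv1
  obtain ⟨n, hn⟩ : ∃ n, P n = P (n + 1) := by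
    by_contra! hne
    have hmono : Monotone P := fun m n hmn p hp => relPow_mono hrefl hmn hp
    exact not_injective_infinite_finite P
      (strictMono_nat_of_lt_succ fun n =>
        lt_of_le_of_ne (hmono n.le_succ) (hne n)).injective
  have hclosed : ∀ a b, relPow R (n + 1) a b → relPow R n a b := fun a b h => by
    have : (a, b) ∈ (P (n + 1)).1 := h
    rw [← hn] at this
    exact this
  have : Relation.ReflTransGen R = relPow R n := by
    funext a b
    refine propext ⟨fun h => ?_, fun h => reflTransGen_iff_relPow.2 ⟨n, h⟩⟩
    induction h with
    | refl => exact relPow_mono hrefl (Nat.zero_le n) rfl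
    | tail _ h ih => exact hclosed _ _ ⟨_, ih, h⟩
  rw [this]
  exact relPow_def hR n

end Powers

/-! ### Minimal graphs: density of triangles, separation, closed triples -/

section Minimal

variable {G : Type v} [Group G] {A : Type u} [MulAction G A]

/-- A definable invariant digraph whose factor graph is loopless and symmetric. -/
structure FactorGraph (G : Type v) [Group G] {A : Type u} [MulAction G A] (𝒞 : RelClone A)
    (E : A → A → Prop) : Prop where
  orb : ∀ a, 𝒞.Def1 (MulAction.orbit G a)
  edge : 𝒞.Def2 E
  inv : Inv2 G E
  symm : ∀ {a b}, Fac G E a b → Fac G E b a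
  irrefl : ∀ {a}, ¬ Fac G E a a

/-- A factor graph with a triangle all of whose proper definable induced subgraphs are 2-colourable
and which has no proper definable quotients. -/
structure MinimalGraph (G : Type v) [Group G] {A : Type u} [MulAction G A] (𝒞 : RelClone A)
    (E : A → A → Prop) : Prop extends FactorGraph G 𝒞 E where
  tri : ∃ a b c, Fac G E a b ∧ Fac G E b c ∧ Fac G E a c
  bip : ∀ X, 𝒞.Def1 X → Inv1 G X → X ≠ Set.univ →
    ∃ S : Set A, ∀ a ∈ X, ∀ b ∈ X, Fac G E a b → (a ∈ S ↔ b ∉ S)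
  quot : ∀ R, 𝒞.Def2 R → Inv2 G R → Equivalence R → (∀ a b, R a b → ¬ Fac G E a b) →
    ∀ a b, R a b → a = b

/-- The set of out-neighbours of a set of vertices. -/
def nbr (E : A → A → Prop) (X : Set A) : Set A := {b | ∃ a ∈ X, E a b}

theorem nbr_mono {E : A → A → Prop} {X Y : Set A} (h : X ⊆ Y) : nbr E X ⊆ nbr E Y :=
  fun _ ⟨a, ha, hab⟩ => ⟨a, h ha, hab⟩

theorem Fac.out_orbit {R : A → A → Prop} {a b : A} (h : Fac G R a b) : ∃ c ∈ MulAction.orbit G b, R a c := by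
  obtain ⟨g, h⟩ := h
  exact ⟨_, ⟨g, rfl⟩, h⟩

namespace FactorGraph

variable {𝒞 : RelClone A} {E : A → A → Prop} (M : FactorGraph G 𝒞 E)
include M

theorem comm {a b : A} : Fac G E a b ↔ Fac G E b a := ⟨M.symm, M.symm⟩

theorem nbr_def {X : Set A} (hX : 𝒞.Def1 X) : 𝒞.Def1 (nbr E X) := M.edge.image hX

theorem nbr_inv {X : Set A} (hX : Inv1 G X) : Inv1 G (nbr E X) := M.inv.image hX

theorem mem_nbr {X : Set A} (hX : Inv1 G X) {a b : A} (ha : a ∈ X) (hab : Fac G E a b) :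
    b ∈ nbr E X := by
  obtain ⟨g, h⟩ := hab
  exact ⟨g⁻¹ • a, hX _ ha, by simpa using M.inv g⁻¹ h⟩

theorem out_nbr {X : Set A} (hX : Inv1 G X) {b : A} (hb : b ∈ nbr E X) : ∃ a ∈ X, E b a := by
  obtain ⟨a, ha, hab⟩ := hb
  obtain ⟨g, h⟩ := M.symm (Fac.of (G := G) hab)
  exact ⟨g • a, hX g ha, h⟩

theorem mem_nbr_orbit {a b : A} : b ∈ nbr E (MulAction.orbit G a) ↔ Fac G E a b := by
  constructor
  · rintro ⟨_, ⟨g, rfl⟩, h⟩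
    exact (fac_smul_left M.inv g).1 (Fac.of h)
  · exact M.mem_nbr (inv1_orbit a) (MulAction.mem_orbit_self a)

theorem nbr_orbit_def (a : A) : 𝒞.Def1 (nbr E (MulAction.orbit G a)) := M.nbr_def (M.orb a)

theorem nbr_orbit_inv (a : A) : Inv1 G (nbr E (MulAction.orbit G a)) := M.nbr_inv (inv1_orbit a)

theorem in_orbit {a b : A} (h : Fac G E a b) : ∃ c ∈ MulAction.orbit G b, E c a := by
  obtain ⟨c, hc, h⟩ := M.mem_nbr (inv1_orbit b) (MulAction.mem_orbit_self b) (M.symm h)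
  exact ⟨c, hc, h⟩

theorem fac_flip {a b : A} : Fac G (fun a b => E b a) a b ↔ Fac G E a b := by
  rw [M.comm]
  constructor
  · rintro ⟨g, h⟩
    exact (fac_smul_left M.inv g).1 (Fac.of h)
  · intro h
    obtain ⟨c, ⟨g, rfl⟩, h⟩ := M.in_orbit (M.symm h)
    exact ⟨g, h⟩

theorem flip : FactorGraph G 𝒞 (fun a b => E b a) where
  orb := M.orb
  edge := M.edge.flip
  inv := M.inv.flip
  symm h := M.fac_flip.2 (M.symm (M.fac_flip.1 h))
  irrefl h := M.irrefl (M.fac_flip.1 h)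

end FactorGraph

namespace MinimalGraph

variable {𝒞 : RelClone A} {E : A → A → Prop} (M : MinimalGraph G 𝒞 E)
include M

/-- The factor graph is symmetric, so reversing `E` does not change it. Results on in-neighbours
therefore transfer to out-neighbours. -/
theorem flip : MinimalGraph G 𝒞 (fun a b => E b a) where
  __ := M.toFactorGraph.flip
  tri := by simpa only [M.fac_flip] using M.tri
  bip := by simpa only [M.fac_flip] using M.bip
  quot := by simpa only [M.fac_flip] using M.quot

theorem eq_univ {X : Set A} (hX : 𝒞.Def1 X) (hI : Inv1 G X) {a b c : A} (ha : a ∈ X) (hb : b ∈ X)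
    (hc : c ∈ X) (hab : Fac G E a b) (hbc : Fac G E b c) (hac : Fac G E a c) : X = Set.univ := by
  by_contra h
  obtain ⟨S, hS⟩ := M.bip X hX hI h
  have h1 := hS a ha b hb hab
  have h2 := hS b hb c hc hbc
  have h3 := hS a ha c hc hac
  tauto

/-- The second neighbourhood of `o` contains all of the triangle, hence everything. -/
theorem exists_path_of_tri {o a b : A} (hoa : Fac G E o a) (hab : Fac G E a b) (hob : Fac G E o b)
    (x : A) : ∃ z, Fac G E o z ∧ Fac G E z x := by
  have h := M.eq_univ (M.nbr_def (M.nbr_orbit_def o)) (M.nbr_inv (M.nbr_orbit_inv o))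
    (a := o) (b := a) (c := b)
    (M.mem_nbr (M.nbr_orbit_inv o) (M.mem_nbr_orbit.2 hoa) (M.symm hoa))
    (M.mem_nbr (M.nbr_orbit_inv o) (M.mem_nbr_orbit.2 hob) (M.symm hab))
    (M.mem_nbr (M.nbr_orbit_inv o) (M.mem_nbr_orbit.2 hoa) hab) hoa hab hob
  obtain ⟨z, hz, hzx⟩ : x ∈ nbr E (nbr E (MulAction.orbit G o)) := h ▸ Set.mem_univ x
  exact ⟨z, M.mem_nbr_orbit.1 hz, .of hzx⟩

theorem exists_tri (x : A) : ∃ a b, Fac G E x a ∧ Fac G E a b ∧ Fac G E x b := by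
  obtain ⟨o, p, q, hop, hpq, hoq⟩ := M.tri
  have key : ∀ t, (∃ z, Fac G E t z ∧ Fac G E z x) →
      t ∈ nbr E (nbr E (MulAction.orbit G x)) := by
    rintro t ⟨z, h1, h2⟩
    exact M.mem_nbr (M.nbr_orbit_inv x) (M.mem_nbr_orbit.2 (M.symm h2)) (M.symm h1)
  have h2 : nbr E (nbr E (MulAction.orbit G x)) = Set.univ :=
    M.eq_univ (M.nbr_def (M.nbr_orbit_def x)) (M.nbr_inv (M.nbr_orbit_inv x))
      (key o (M.exists_path_of_tri hop hpq hoq x))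
      (key p (M.exists_path_of_tri (M.symm hop) hoq hpq x))
      (key q (M.exists_path_of_tri (M.symm hoq) hop (M.symm hpq) x)) hop hpq hoq
  obtain ⟨a, ha, hax⟩ : x ∈ nbr E (nbr E (MulAction.orbit G x)) := h2 ▸ Set.mem_univ x
  obtain ⟨b, hb, hba⟩ : a ∈ nbr E (nbr E (MulAction.orbit G x)) := h2 ▸ Set.mem_univ a
  exact ⟨a, b, M.mem_nbr_orbit.1 ha, M.symm (.of hba), M.mem_nbr_orbit.1 hb⟩

theorem exists_path (x y : A) : ∃ z, Fac G E x z ∧ Fac G E z y := by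
  obtain ⟨a, b, h1, h2, h3⟩ := M.exists_tri x
  exact M.exists_path_of_tri h1 h2 h3 y

/-- A path of length two from `p` to `q` completes the edge to a triangle, which lies in the
neighbourhood of `X`. -/
theorem nbr_eq_univ {X : Set A} (hX : 𝒞.Def1 X) (hI : Inv1 G X) {p q : A} (hp : p ∈ X)
    (hq : q ∈ X) (hpq : Fac G E p q) : nbr E X = Set.univ := by
  obtain ⟨z, h1, h2⟩ := M.exists_path p q
  exact M.eq_univ (M.nbr_def hX) (M.nbr_inv hI) (M.mem_nbr hI hq (M.symm hpq))
    (M.mem_nbr hI hp hpq) (M.mem_nbr hI hp h1) hpq (M.symm h2) h1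

theorem nbr_nbr_eq_univ (x : A) : nbr E (nbr E (MulAction.orbit G x)) = Set.univ := by
  obtain ⟨a, b, h1, h2, h3⟩ := M.exists_tri x
  exact M.nbr_eq_univ (M.nbr_orbit_def x) (M.nbr_orbit_inv x) (M.mem_nbr_orbit.2 h1)
    (M.mem_nbr_orbit.2 h3) h2

/-- Separation of an edge from two points with a common out-neighbour `x`, provided some neighbour
of `x` has no common neighbour with the edge. -/
theorem separate_of_no_common {x y y' p q g : A} (hy : E y x) (hy' : E y' x) (hg : Fac G E g x)
    (hpq : ∀ u, Fac G E u g → Fac G E u p → ¬ Fac G E u q) :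
    ∃ S : A → A → Prop, 𝒞.Def2 S ∧ Inv2 G S ∧ (∀ a, S a a) ∧ (∀ a b, S a b → S b a) ∧ S y y' ∧
      ¬ S p q := by
  refine ⟨fun a b => ∃ u ∈ nbr E (MulAction.orbit G g), E a u ∧ E b u, ?_, ?_, ?_, ?_, ?_, ?_⟩
  · exact RelClone.Def.ex (P := fun x u => u ∈ nbr E (MulAction.orbit G g) ∧ E (x false) u ∧
      E (x true) u) (((M.nbr_orbit_def g).app _).and ((M.edge.app _ _).and (M.edge.app _ _)))
  · rintro k a b ⟨u, hu, h1, h2⟩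
    exact ⟨k • u, M.nbr_orbit_inv g k hu, M.inv k h1, M.inv k h2⟩
  · intro a
    obtain ⟨u, hu, h⟩ := M.out_nbr (M.nbr_orbit_inv g)
      (show a ∈ nbr E (nbr E (MulAction.orbit G g)) from M.nbr_nbr_eq_univ g ▸ Set.mem_univ a)
    exact ⟨u, hu, h, h⟩
  · rintro a b ⟨u, hu, h1, h2⟩
    exact ⟨u, hu, h2, h1⟩
  · exact ⟨x, M.mem_nbr_orbit.2 hg, hy, hy'⟩
  · rintro ⟨u, hu, h1, h2⟩
    exact hpq u (M.symm (M.mem_nbr_orbit.1 hu)) (M.symm (.of h1)) (M.symm (.of h2))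

variable [hfin : Finite (MulAction.orbitRel.Quotient G (A × A))]

/-- A definable invariant reflexive symmetric relation that avoids the graph is trivial. -/
theorem eq_of_avoid {S : A → A → Prop} (hS : 𝒞.Def2 S) (hI : Inv2 G S) (hr : ∀ a, S a a)
    (hs : ∀ a b, S a b → S b a) (hE : ∀ a b, S a b → ¬ Fac G E a b) {a b : A} (hab : S a b) :
    a = b := by
  have avoid : ∀ n a b, relPow S n a b → ¬ Fac G E a b := by
    intro n
    induction n using Nat.strong_induction_on with
    | _ n ih =>
    intro a b hab hE'
    rcases Nat.lt_or_ge n 2 with hn | hn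
    · interval_cases n
      · obtain rfl : a = b := hab
        exact M.irrefl hE'
      · exact hE a b (relPow_one.1 hab) hE'
    -- Half of `n`, rounded up: both ends of the path are within `m` steps of the midpoint `c`, and
    -- `m < n` because `n ≥ 2`.
    · obtain ⟨m, hm1, hm2, hm3⟩ : ∃ m, m < n ∧ n - m ≤ m ∧ m ≤ n :=
        ⟨(n + 1) / 2, by omega, by omega, by omega⟩
      obtain ⟨c, hac, hcb⟩ := (relPow_add (R := S) (m := m) (n := n - m)).1
        (by rwa [Nat.add_sub_cancel' hm3])
      have hca := relPow_symm hs hac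
      have hcb' := relPow_mono hr hm2 hcb
      -- The ball around the orbit of `c` contains the edge `a`, `b`, so its neighbourhood is
      -- everything. In particular `c` has a neighbour in the ball, which is a factor edge inside
      -- the `m`-th power.
      let B : Set A := {z | ∃ y ∈ MulAction.orbit G c, relPow S m y z}
      have hB : 𝒞.Def1 B := (relPow_def hS m).image (M.orb c)
      have hBI : Inv1 G B := (relPow_inv hI m).image (inv1_orbit c)
      have haB : a ∈ B := ⟨c, MulAction.mem_orbit_self c, hca⟩
      have hbB : b ∈ B := ⟨c, MulAction.mem_orbit_self c, hcb'⟩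
      obtain ⟨z, ⟨_, ⟨g, rfl⟩, hyz⟩, hzc⟩ : c ∈ nbr E B :=
        M.nbr_eq_univ hB hBI haB hbB hE' ▸ Set.mem_univ c
      exact ih m hm1 _ _ hyz ((fac_smul_left M.inv g).2 (M.symm (.of hzc)))
  refine M.quot (Relation.ReflTransGen S) (reflTransGen_def hS hI hr) hI.reflTransGen
    ⟨fun _ => .refl, fun h => reflTransGen_symm hs h,
      fun h h' => h.trans h'⟩ ?_ a b (.single hab)
  intro a b h
  obtain ⟨n, hn⟩ := reflTransGen_iff_relPow.1 h
  exact avoid n a b hn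

/-- Two points are equal if every edge is avoided by a definable invariant reflexive symmetric
relation containing them. -/
theorem eq_of_separated {y y' : A} (h : ∀ a b, Fac G E a b → ∃ S : A → A → Prop, 𝒞.Def2 S ∧
    Inv2 G S ∧ (∀ a, S a a) ∧ (∀ a b, S a b → S b a) ∧ S y y' ∧ ¬ S a b) : y = y' := by
  let F : Set (Set (A × A)) := {X | Inv1 G X ∧ 𝒞.Def2 (fun a b => (a, b) ∈ X) ∧
    (∀ a, (a, a) ∈ X) ∧ (∀ a b, (a, b) ∈ X → (b, a) ∈ X) ∧ (y, y') ∈ X}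
  have hF : F.Finite := finite_inv1.subset fun X hX => hX.1
  refine M.eq_of_avoid (S := fun a b => (a, b) ∈ ⋂₀ F)
    (RelClone.def2_sInter hF fun X hX => hX.2.1) ?_ ?_ ?_ ?_ ?_
  · exact fun g a b hab X hX => hX.1 g (hab X hX)
  · exact fun a X hX => hX.2.2.1 a
  · exact fun a b hab X hX => hX.2.2.2.1 a b (hab X hX)
  · intro a b hab hE
    obtain ⟨S, h1, h2, h3, h4, h5, h6⟩ := h a b hE
    exact h6 (hab {p | S p.1 p.2} ⟨fun g p hp => h2 g hp, h1, h3, h4, h5⟩)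
  · exact fun X hX => hX.2.2.2.2

/-- A triangle is contained in a triple of independent sets each of which is the common
neighbourhood of the other two. -/
theorem closed_triple (t : Fin 3 → A) (ht : ∀ i j, i ≠ j → Fac G E (t i) (t j)) :
    ∃ X : Fin 3 → Set A, (∀ i, 𝒞.Def1 (X i)) ∧ (∀ i, Inv1 G (X i)) ∧ (∀ i, t i ∈ X i) ∧
      (∀ i, ∀ a ∈ X i, ∀ b ∈ X i, ¬ Fac G E a b) ∧
      ∀ i a, a ∈ X i ↔ ∀ j, j ≠ i → a ∈ nbr E (X j) := by
  have := finite_orbits_of_pairs (G := G) (A := A)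
  -- Connectedness of the bipartite graph between `X` and `Y`, phrased through 2-colourings so that
  -- it applies to those supplied by `bip`.
  let Mono : Set A → Set A → Prop := fun X Y =>
    ∀ S : Set A, (∀ a ∈ X, ∀ b ∈ Y, Fac G E a b → (a ∈ S ↔ b ∉ S)) →
      ((∀ a ∈ X, a ∈ S) ∧ ∀ b ∈ Y, b ∉ S) ∨ ((∀ a ∈ X, a ∉ S) ∧ ∀ b ∈ Y, b ∈ S)
  let T : Set (Fin 3 → Set A) := {X | (∀ i, 𝒞.Def1 (X i)) ∧ (∀ i, Inv1 G (X i)) ∧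
    (∀ i, t i ∈ X i) ∧ (∀ i, ∀ a ∈ X i, ∀ b ∈ X i, ¬ Fac G E a b) ∧
    (∀ i j, i ≠ j → Mono (X i) (X j)) ∧ ∀ i j, j ≠ i → X i ⊆ nbr E (X j)}
  have hT : T.Finite := (Set.Finite.pi' fun _ : Fin 3 => finite_inv1 (G := G) (A := A)).subset
    fun X hX => hX.2.1
  have hne : T.Nonempty := by
    refine ⟨fun i => MulAction.orbit G (t i), fun i => M.orb _, fun i => inv1_orbit _,
      fun i => MulAction.mem_orbit_self _, ?_, ?_, ?_⟩
    · intro i a ha b hb hab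
      rw [fac_orbit_right hb, fac_orbit_left M.inv ha] at hab
      exact M.irrefl hab
    · intro i j hij S hS
      have hS' : ∀ a ∈ MulAction.orbit G (t i), ∀ b ∈ MulAction.orbit G (t j),
          (a ∈ S ↔ b ∉ S) := fun a ha b hb => hS a ha b hb
            ((fac_orbit_left M.inv ha).2 ((fac_orbit_right hb).2 (ht i j hij)))
      have hi := MulAction.mem_orbit_self (M := G) (t i)
      have hj := MulAction.mem_orbit_self (M := G) (t j)
      by_cases h : t i ∈ S
      · exact Or.inl ⟨fun a ha => (hS' a ha _ hj).2 ((hS' _ hi _ hj).1 h),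
          fun b hb => (hS' _ hi b hb).1 h⟩
      · have hj' : t j ∈ S := by
          by_contra h'
          exact h ((hS' _ hi _ hj).2 h')
        exact Or.inr ⟨fun a ha ha' => (hS' a ha _ hj).1 ha' hj',
          fun b hb => by_contra fun h' => h ((hS' _ hi b hb).2 h')⟩
    · intro i j hij a ha
      exact M.mem_nbr_orbit.2 ((fac_orbit_right ha).2 (ht j i hij))
  obtain ⟨X, hX⟩ := hT.exists_maximal hne
  obtain ⟨hdef, hinv, hmem, hind, hmono, hconn⟩ := hX.1
  -- The closure of a maximal triple is shown to lie in `T` again, so it equals the triple.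
  let X' : Fin 3 → Set A := fun i => {a | ∀ j, j ≠ i → a ∈ nbr E (X j)}
  have hXX' : ∀ i, X i ⊆ X' i := fun i a ha j hj => hconn i j hj ha
  have third : ∀ i j : Fin 3, i ≠ j → ∃ k, k ≠ i ∧ k ≠ j := by decide
  have other : ∀ i : Fin 3, ∃ j, j ≠ i := by decide
  have hX' : X' ∈ T := by
    refine ⟨fun i => ?_, fun i g a ha j hj => M.nbr_inv (hinv j) g (ha j hj),
      fun i => hXX' i (hmem i), ?_, ?_, ?_⟩
    · exact RelClone.Def.all fun j => RelClone.Def.imp fun _ => M.nbr_def (hdef j)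
    · intro i a ha b hb hab
      obtain ⟨j, hj⟩ := other i
      obtain ⟨k, hki, hkj⟩ := third i j hj.symm
      -- The neighbourhood of `X j` is proper, hence 2-coloured by some `S`. Connectedness puts `X
      -- k` into one class. Each point of `X' i` has a neighbour in `X k`, so `X' i` lies in the
      -- other class and spans no edge.
      have hne : nbr E (X j) ≠ Set.univ := by
        intro h
        obtain ⟨c, hc, hct⟩ : t j ∈ nbr E (X j) := h ▸ Set.mem_univ _
        exact hind j c hc _ (hmem j) (.of hct)
      obtain ⟨S, hS⟩ := M.bip _ (M.nbr_def (hdef j)) (M.nbr_inv (hinv j)) hne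
      have hi : X i ⊆ nbr E (X j) := hconn i j hj
      have hk : X k ⊆ nbr E (X j) := hconn k j hkj.symm
      have side : ∀ c ∈ X' i, ∃ d ∈ X k, Fac G E c d := by
        intro c hc
        obtain ⟨d, hd, h⟩ := M.out_nbr (hinv k) (hc k hki)
        exact ⟨d, hd, .of h⟩
      obtain ⟨d, hd, had⟩ := side a ha
      obtain ⟨e, he, hbe⟩ := side b hb
      have h1 := hS a (ha j hj) d (hk hd) had
      have h2 := hS b (hb j hj) e (hk he) hbe
      have h3 := hS a (ha j hj) b (hb j hj) hab
      rcases hmono i k hki.symm S (fun a ha b hb => hS a (hi ha) b (hk hb)) with h | h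
      · have h4 := h.2 d hd
        have h5 := h.2 e he
        tauto
      · have h4 := h.2 d hd
        have h5 := h.2 e he
        tauto
    · intro i j hij S hS
      have hl : ∀ a ∈ X' i, ∃ b ∈ X j, Fac G E a b := fun a ha => by
        obtain ⟨d, hd, h⟩ := M.out_nbr (hinv j) (ha j hij.symm)
        exact ⟨d, hd, .of h⟩
      have hr : ∀ b ∈ X' j, ∃ a ∈ X i, Fac G E a b := fun b hb => by
        obtain ⟨a, ha, h⟩ := hb i hij
        exact ⟨a, ha, .of h⟩
      rcases hmono i j hij S (fun a ha b hb => hS a (hXX' i ha) b (hXX' j hb)) with h | h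
      · refine Or.inl ⟨fun a ha => ?_, fun b hb => ?_⟩
        · obtain ⟨b, hb, hab⟩ := hl a ha
          exact (hS a ha b (hXX' j hb) hab).2 (h.2 b hb)
        · obtain ⟨a, ha, hab⟩ := hr b hb
          exact (hS a (hXX' i ha) b hb hab).1 (h.1 a ha)
      · refine Or.inr ⟨fun a ha => ?_, fun b hb => ?_⟩
        · obtain ⟨b, hb, hab⟩ := hl a ha
          exact fun ha' => (hS a ha b (hXX' j hb) hab).1 ha' (h.2 b hb)
        · obtain ⟨a, ha, hab⟩ := hr b hb
          exact by_contra fun hb' => h.1 a ha ((hS a (hXX' i ha) b hb hab).2 hb')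
    · intro i j hij a ha
      exact nbr_mono (hXX' j) (ha j hij)
  exact ⟨X, hdef, hinv, hmem, hind, fun i a => ⟨fun ha => hXX' i ha, fun ha => hX.2 hX' hXX' i ha⟩⟩

/-- For every edge `p`, `q` and every `y` there is an edge `K`, `K'` in the definable hull of `p`,
`q` with `K` adjacent to `y`. -/
theorem exists_hull_edge {p q : A} (hpq : Fac G E p q) (y : A) :
    ∃ K K', Fac G E K y ∧ Fac G E K K' ∧
      ∀ X, 𝒞.Def1 X → Inv1 G X → p ∈ X → q ∈ X → K ∈ X ∧ K' ∈ X := by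
  have := finite_orbits_of_pairs (G := G) (A := A)
  let F : Set (Set A) := {X | Inv1 G X ∧ 𝒞.Def1 X ∧ p ∈ X ∧ q ∈ X}
  have hF : F.Finite := finite_inv1.subset fun X hX => hX.1
  have hD : 𝒞.Def1 (⋂₀ F) := RelClone.def1_sInter hF fun X hX => hX.2.1
  have hDI : Inv1 G (⋂₀ F) := fun g a ha X hX => hX.1 g (ha X hX)
  have hp : p ∈ ⋂₀ F := fun X hX => hX.2.2.1
  have hq : q ∈ ⋂₀ F := fun X hX => hX.2.2.2
  obtain ⟨K, hK, hKy⟩ : y ∈ nbr E (⋂₀ F) := M.nbr_eq_univ hD hDI hp hq hpq ▸ Set.mem_univ y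
  obtain ⟨K', hK', hKK'⟩ : K ∈ nbr E (⋂₀ F) := M.nbr_eq_univ hD hDI hp hq hpq ▸ Set.mem_univ K
  exact ⟨K, K', .of hKy, M.symm (.of hKK'), fun X hX hI hpX hqX =>
    ⟨hK X ⟨hI, hX, hpX, hqX⟩, hK' X ⟨hI, hX, hpX, hqX⟩⟩⟩

end MinimalGraph

end Minimal

/-! ### Minimal graphs: the factor graph is a triangle with unique neighbours -/

section Minimal

variable {G : Type v} [Group G] {A : Type u} [MulAction G A]

/-- Existence of a zigzag of four edges from `a` to `b` whose inner vertices lie in `U`, `V`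
and `W`. -/
def Zigzag (E : A → A → Prop) (U V W : Set A) (a b : A) : Prop :=
  ∃ u₁ ∈ U, ∃ u₂ ∈ V, ∃ u₃ ∈ W, E a u₁ ∧ E u₂ u₁ ∧ E u₂ u₃ ∧ E b u₃

theorem zigzag_eq (E : A → A → Prop) (U V W : Set A) :
    Zigzag E U V W = Relation.Comp (fun a b => E a b ∧ b ∈ U) (Relation.Comp
      (fun a b => E b a ∧ b ∈ V) (Relation.Comp (fun a b => E a b ∧ b ∈ W) fun a b => E b a)) := by
  funext a b
  refine propext ⟨?_, ?_⟩
  · rintro ⟨u₁, h1, u₂, h2, u₃, h3, e1, e2, e3, e4⟩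
    exact ⟨u₁, ⟨e1, h1⟩, u₂, ⟨e2, h2⟩, u₃, ⟨e3, h3⟩, e4⟩
  · rintro ⟨u₁, ⟨e1, h1⟩, u₂, ⟨e2, h2⟩, u₃, ⟨e3, h3⟩, e4⟩
    exact ⟨u₁, h1, u₂, h2, u₃, h3, e1, e2, e3, e4⟩

theorem zigzag_def {𝒞 : RelClone A} {E : A → A → Prop} (hE : 𝒞.Def2 E) {U V W : Set A}
    (hU : 𝒞.Def1 U) (hV : 𝒞.Def1 V) (hW : 𝒞.Def1 W) : 𝒞.Def2 (Zigzag E U V W) := by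
  rw [zigzag_eq]
  have h : ∀ {R : A → A → Prop} {X : Set A}, 𝒞.Def2 R → 𝒞.Def1 X →
      𝒞.Def2 fun a b => R a b ∧ b ∈ X := fun hR hX => RelClone.Def.and hR (hX.app true)
  exact (h hE hU).comp ((h hE.flip hV).comp ((h hE hW).comp hE.flip))

theorem zigzag_inv {E : A → A → Prop} (hE : Inv2 G E) {U V W : Set A}
    (hU : Inv1 G U) (hV : Inv1 G V) (hW : Inv1 G W) : Inv2 G (Zigzag E U V W) := by
  rintro g a b ⟨u₁, h1, u₂, h2, u₃, h3, e1, e2, e3, e4⟩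
  exact ⟨_, hU g h1, _, hV g h2, _, hW g h3, hE g e1, hE g e2, hE g e3, hE g e4⟩

namespace MinimalGraph

variable {𝒞 : RelClone A} {E : A → A → Prop} (M : MinimalGraph G 𝒞 E)
  [hfin : Finite (MulAction.orbitRel.Quotient G (A × A))]
include M hfin

/-- A triangle `i`, `K`, `K'` over the hull of the edge extends to a closed triple with `y` and `y'`
in `X 2`. A zigzag relation that preserves `X 2` links `y` to `y'`, but cannot link `p` to `q`. -/
theorem separate_of_common {x y y' v p q : A} (hpq : Fac G E p q) (hy : E y x) (hy' : E y' x)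
    (hvx : Fac G E v x) (hvy : Fac G E v y) (hvy' : Fac G E v y')
    (H : ∀ g, Fac G E g x → ∃ u, Fac G E u g ∧ Fac G E u p ∧ Fac G E u q) :
    ∃ S : A → A → Prop, 𝒞.Def2 S ∧ Inv2 G S ∧ (∀ a, S a a) ∧ (∀ a b, S a b → S b a) ∧ S y y' ∧
      ¬ S p q := by
  obtain ⟨i, hiy, hip, hiq⟩ := H y (.of hy)
  obtain ⟨i', hiv', hip', hiq'⟩ := H v hvx
  obtain ⟨K, K', hKy, hKK, hull⟩ := M.exists_hull_edge hpq y
  -- The neighbourhood of the orbit of `j` is itself a definable invariant set, so once it contains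
  -- `p` and `q` it contains `K` and `K'`.
  have hK : ∀ j, Fac G E j p → Fac G E j q → Fac G E j K ∧ Fac G E j K' := by
    intro j h1 h2
    obtain ⟨h3, h4⟩ := hull _ (M.nbr_orbit_def j) (M.nbr_orbit_inv j) (M.mem_nbr_orbit.2 h1)
      (M.mem_nbr_orbit.2 h2)
    exact ⟨M.mem_nbr_orbit.1 h3, M.mem_nbr_orbit.1 h4⟩
  obtain ⟨hiK, hiK'⟩ := hK i hip hiq
  obtain ⟨hiK1, hiK1'⟩ := hK i' hip' hiq'
  obtain ⟨X, hdef, hinv, hmem, hind, hX⟩ := M.closed_triple ![i, K, K'] (by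
    intro a b hab
    fin_cases a <;> fin_cases b <;>
      first | exact absurd rfl hab | simp [hiK, hiK', hKK, M.symm hiK, M.symm hiK', M.symm hKK])
  have hX0 : ∀ a, a ∈ X 0 ↔ a ∈ nbr E (X 1) ∧ a ∈ nbr E (X 2) := fun a => by
    rw [hX]
    exact ⟨fun h => ⟨h 1 (by decide), h 2 (by decide)⟩, fun h j hj => by
      fin_cases j <;> simp_all⟩
  have hX1 : ∀ a, a ∈ X 1 ↔ a ∈ nbr E (X 0) ∧ a ∈ nbr E (X 2) := fun a => by
    rw [hX]
    exact ⟨fun h => ⟨h 0 (by decide), h 2 (by decide)⟩, fun h j hj => by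
      fin_cases j <;> simp_all⟩
  have hX2 : ∀ a, a ∈ X 2 ↔ a ∈ nbr E (X 0) ∧ a ∈ nbr E (X 1) := fun a => by
    rw [hX]
    exact ⟨fun h => ⟨h 0 (by decide), h 1 (by decide)⟩, fun h j hj => by
      fin_cases j <;> simp_all⟩
  have hi0 : i ∈ X 0 := hmem 0
  have hK1 : K ∈ X 1 := hmem 1
  have hK2 : K' ∈ X 2 := hmem 2
  have N : ∀ {j a b}, a ∈ X j → Fac G E a b → b ∈ nbr E (X j) := fun ha h =>
    M.mem_nbr (hinv _) ha h
  have hi'0 : i' ∈ X 0 := (hX0 _).2 ⟨N hK1 (M.symm hiK1), N hK2 (M.symm hiK1')⟩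
  have hy2 : y ∈ X 2 := (hX2 _).2 ⟨N hi0 hiy, N hK1 hKy⟩
  have hv1 : v ∈ X 1 := (hX1 _).2 ⟨N hi'0 hiv', N hy2 (M.symm hvy)⟩
  have hx0 : x ∈ X 0 := (hX0 _).2 ⟨N hv1 hvx, N hy2 (.of hy)⟩
  have hy'2 : y' ∈ X 2 := (hX2 _).2 ⟨N hx0 (M.symm (.of hy')), N hv1 hvy'⟩
  have out : ∀ {j a}, a ∈ nbr E (X j) → ∃ b ∈ X j, E a b := fun h => M.out_nbr (hinv _) h
  -- From a point of `X 2`, closedness of the triple forces a zigzag of `P₁` through `X 0`, `X 2`,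
  -- `X 1` and one of `P₂` through `X 0`, `X 2`, `X 0`. A common endpoint is adjacent to both `X 1`
  -- and `X 0`, so it is in `X 2`.
  let P₁ := Zigzag E (nbr E (X 1)) (nbr E (X 1)) (nbr E (X 0))
  let P₂ := Zigzag E (nbr E (X 1)) (nbr E (X 1)) (nbr E (X 1))
  have hNd : ∀ j, 𝒞.Def1 (nbr E (X j)) := fun j => M.nbr_def (hdef j)
  have hNi : ∀ j, Inv1 G (nbr E (X j)) := fun j => M.nbr_inv (hinv j)
  let P : A → A → Prop := fun a b => P₁ a b ∧ P₂ a b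
  have hPd : 𝒞.Def2 P := (zigzag_def M.edge (hNd 1) (hNd 1) (hNd 0)).and
    (zigzag_def M.edge (hNd 1) (hNd 1) (hNd 1))
  have hPi : Inv2 G P := (zigzag_inv M.inv (hNi 1) (hNi 1) (hNi 0)).and
    (zigzag_inv M.inv (hNi 1) (hNi 1) (hNi 1))
  have h01 : X 0 ⊆ nbr E (X 1) := fun a h => ((hX0 a).1 h).1
  have h02 : X 0 ⊆ nbr E (X 2) := fun a h => ((hX0 a).1 h).2
  have h10 : X 1 ⊆ nbr E (X 0) := fun a h => ((hX1 a).1 h).1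
  have h12 : X 1 ⊆ nbr E (X 2) := fun a h => ((hX1 a).1 h).2
  have h20 : X 2 ⊆ nbr E (X 0) := fun a h => ((hX2 a).1 h).1
  have h21 : X 2 ⊆ nbr E (X 1) := fun a h => ((hX2 a).1 h).2
  -- Reflexivity is only checked on the triangle `i`, `K`, `K'`; minimality extends it to all
  -- points.
  have hdiag : {a | P a a} = Set.univ := by
    refine M.eq_univ hPd.diag hPi.diag (a := i) (b := K) (c := K') ?_ ?_ ?_ hiK hKK hiK'
    · obtain ⟨b, hb, h⟩ := out (h02 hi0)
      exact ⟨⟨b, h21 hb, i, h01 hi0, b, h20 hb, h, h, h, h⟩,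
        ⟨b, h21 hb, i, h01 hi0, b, h21 hb, h, h, h, h⟩⟩
    · obtain ⟨b, hb, h⟩ := out (h12 hK1)
      obtain ⟨c, hc, h'⟩ := h20 hb
      exact ⟨⟨b, h21 hb, c, h01 hc, b, h20 hb, h, h', h', h⟩,
        ⟨b, h21 hb, c, h01 hc, b, h21 hb, h, h', h', h⟩⟩
    · obtain ⟨b, hb, h⟩ := out (h20 hK2)
      obtain ⟨c, hc, h'⟩ := out (h21 hK2)
      exact ⟨⟨b, h01 hb, K', h21 hK2, c, h10 hc, h, h, h', h'⟩,
        ⟨b, h01 hb, K', h21 hK2, b, h01 hb, h, h, h, h⟩⟩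
  have hrefl : ∀ a, P a a := fun a => (hdiag ▸ Set.mem_univ a : a ∈ {a | P a a})
  have hPyy' : ∀ z z', z ∈ X 2 → z' ∈ X 2 → E z x → E z' x → P z z' := by
    intro z z' hz hz' e e'
    obtain ⟨c, hc, h⟩ := out (h21 hz')
    exact ⟨⟨x, h01 hx0, z', h21 hz', c, h10 hc, e, e', h, h⟩,
      ⟨x, h01 hx0, z', h21 hz', x, h01 hx0, e, e', e', e'⟩⟩
  have hstable : ∀ a b, P a b → a ∈ X 2 → b ∈ X 2 := by
    rintro a b ⟨⟨u₁, h1, u₂, h2, u₃, h3, e1, e2, e3, e4⟩, ⟨w₁, k1, w₂, k2, w₃, k3, f1, f2, f3, f4⟩⟩ ha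
    have hu₁ : u₁ ∈ X 0 := (hX0 _).2 ⟨h1, N ha (.of e1)⟩
    have hu₂ : u₂ ∈ X 2 := (hX2 _).2 ⟨N hu₁ (M.symm (.of e2)), h2⟩
    have hu₃ : u₃ ∈ X 1 := (hX1 _).2 ⟨h3, N hu₂ (.of e3)⟩
    have hw₁ : w₁ ∈ X 0 := (hX0 _).2 ⟨k1, N ha (.of f1)⟩
    have hw₂ : w₂ ∈ X 2 := (hX2 _).2 ⟨N hw₁ (M.symm (.of f2)), k2⟩
    have hw₃ : w₃ ∈ X 0 := (hX0 _).2 ⟨k3, N hw₂ (.of f3)⟩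
    exact (hX2 _).2 ⟨N hw₃ (M.symm (.of f4)), N hu₃ (M.symm (.of e4))⟩
  let Q : A → A → Prop := fun a b => P a b ∧ P b a
  have hQd : 𝒞.Def2 Q := hPd.and hPd.flip
  have hQi : Inv2 G Q := hPi.and hPi.flip
  have hQs : ∀ a b, Q a b → Q b a := fun a b h => ⟨h.2, h.1⟩
  have hQr : ∀ a, Q a a := fun a => ⟨hrefl a, hrefl a⟩
  have hSd := reflTransGen_def hQd hQi hQr
  refine ⟨Relation.ReflTransGen Q, hSd, hQi.reflTransGen, fun _ => .refl,
    fun a b => reflTransGen_symm hQs,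
    .single ⟨hPyy' y y' hy2 hy'2 hy hy', hPyy' y' y hy'2 hy2 hy' hy⟩, fun hS => ?_⟩
  -- If `p` and `q` were linked, the points linked to the orbit of `p` would include `K` and `K'`.
  -- Then `K'` would be linked to a translate of `K`, and stability would put the adjacent points
  -- `K`, `K'` into the independent set `X 2`.
  obtain ⟨⟨_, ⟨g, rfl⟩, hgK⟩, ⟨_, ⟨g', rfl⟩, hgK'⟩⟩ := hull
    {z | ∃ a ∈ MulAction.orbit G p, Relation.ReflTransGen Q a z}
    (hSd.image (M.orb p)) (hQi.reflTransGen.image (inv1_orbit p))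
    ⟨p, MulAction.mem_orbit_self p, .refl⟩ ⟨p, MulAction.mem_orbit_self p, hS⟩
  have hK'g : Relation.ReflTransGen Q K' ((g' * g⁻¹) • K) := by
    refine (reflTransGen_symm hQs hgK').trans ?_
    simpa [mul_smul] using hQi.reflTransGen (g' * g⁻¹) hgK
  have hstable' : ∀ z, Relation.ReflTransGen Q K' z → z ∈ X 2 := by
    intro z hz
    induction hz with
    | refl => exact hK2
    | tail _ h ih => exact hstable _ _ h.1 ih
  exact hind 2 K (((hinv 2).smul_iff _).1 (hstable' _ hK'g)) K' hK2 hKK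

/-- Two in-neighbours of `x` that have a common neighbour in the factor graph with `x` coincide. -/
theorem eq_of_common {x y y' v : A} (hy : E y x) (hy' : E y' x)
    (hvx : Fac G E v x) (hvy : Fac G E v y) (hvy' : Fac G E v y') : y = y' := by
  refine M.eq_of_separated fun p q hpq => ?_
  by_cases H : ∀ g, Fac G E g x → ∃ u, Fac G E u g ∧ Fac G E u p ∧ Fac G E u q
  · exact M.separate_of_common hpq hy hy' hvx hvy hvy' H
  · push Not at H
    obtain ⟨g, hg, h⟩ := H
    exact M.separate_of_no_common hy hy' hg h

/-- The factor graph contains no diamond. -/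
theorem diamond_free {a b u v : A} (hau : Fac G E a u) (hav : Fac G E a v) (hbu : Fac G E b u)
    (hbv : Fac G E b v) (huv : Fac G E u v) : b ∈ MulAction.orbit G a := by
  obtain ⟨_, ⟨g, rfl⟩, hg⟩ := M.in_orbit (M.symm hau)
  obtain ⟨_, ⟨k, rfl⟩, hk⟩ := M.in_orbit (M.symm hbu)
  have h : g • a = k • b := M.eq_of_common hg hk (M.symm huv)
    ((fac_smul_right g).2 (M.symm hav)) ((fac_smul_right k).2 (M.symm hbv))
  exact ⟨k⁻¹ * g, by simp [mul_smul, h]⟩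

theorem in_unique {x y y' : A} (hy : E y x) (hy' : E y' x) (h : y' ∈ MulAction.orbit G y) :
    y = y' := by
  obtain ⟨v, h1, h2⟩ := M.exists_path x y
  exact M.eq_of_common hy hy' (M.symm h1) h2 ((fac_orbit_right h).2 h2)

theorem out_unique {x y y' : A} (hy : E x y) (hy' : E x y') (h : y' ∈ MulAction.orbit G y) :
    y = y' := M.flip.in_unique hy hy' h

/-- The same configuration as in `separate_of_common`, but now `diamond_free` identifies orbits:
`i'` with `i`, then `v` with `K`, then `x` with `i`. -/
theorem fac_of_common {x y p q : A} (hpq : Fac G E p q) (hy : E y x)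
    (H : ∀ g, Fac G E g x → ∃ u, Fac G E u g ∧ Fac G E u p ∧ Fac G E u q) :
    Fac G E x p ∧ Fac G E x q := by
  obtain ⟨v, hxv, hvy⟩ := M.exists_path x y
  obtain ⟨i, hiy, hip, hiq⟩ := H y (.of hy)
  obtain ⟨i', hiv', hip', hiq'⟩ := H v (M.symm hxv)
  obtain ⟨K, K', hKy, hKK, hull⟩ := M.exists_hull_edge hpq y
  have hK : ∀ j, Fac G E j p → Fac G E j q → Fac G E j K ∧ Fac G E j K' := by
    intro j h1 h2
    obtain ⟨h3, h4⟩ := hull _ (M.nbr_orbit_def j) (M.nbr_orbit_inv j) (M.mem_nbr_orbit.2 h1)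
      (M.mem_nbr_orbit.2 h2)
    exact ⟨M.mem_nbr_orbit.1 h3, M.mem_nbr_orbit.1 h4⟩
  obtain ⟨hiK, hiK'⟩ := hK i hip hiq
  obtain ⟨hiK1, hiK1'⟩ := hK i' hip' hiq'
  have h1 : i' ∈ MulAction.orbit G i := M.diamond_free hiK hiK' hiK1 hiK1' hKK
  have h2 : Fac G E i v := (fac_orbit_left M.inv h1).1 hiv'
  have h3 : v ∈ MulAction.orbit G K :=
    M.diamond_free (M.symm hiK) hKy (M.symm h2) hvy hiy
  have h4 : x ∈ MulAction.orbit G i :=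
    M.diamond_free hiK hiy ((fac_orbit_right h3).1 hxv) (M.symm (.of hy)) hKy
  rw [fac_orbit_left M.inv h4, fac_orbit_left M.inv h4]
  exact ⟨hip, hiq⟩

/-- Two points with common out-neighbours in two different orbits coincide. -/
theorem eq_of_two_common {x x₂ y y' : A} (h1 : E y x) (h2 : E y' x) (h3 : E y x₂) (h4 : E y' x₂)
    (hx : x₂ ∉ MulAction.orbit G x) : y = y' := by
  refine M.eq_of_separated fun p q hpq => ?_
  by_cases H : ∀ g, Fac G E g x → ∃ u, Fac G E u g ∧ Fac G E u p ∧ Fac G E u q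
  · by_cases H' : ∀ g, Fac G E g x₂ → ∃ u, Fac G E u g ∧ Fac G E u p ∧ Fac G E u q
    -- An edge that cannot be separated through `x` or through `x₂` would form a diamond with them.
    · obtain ⟨k1, k2⟩ := M.fac_of_common hpq h1 H
      obtain ⟨k3, k4⟩ := M.fac_of_common hpq h3 H'
      exact absurd (M.diamond_free k1 k2 k3 k4 hpq) hx
    · push Not at H'
      obtain ⟨g, hg, h⟩ := H'
      exact M.separate_of_no_common h3 h4 hg h
  · push Not at H
    obtain ⟨g, hg, h⟩ := H
    exact M.separate_of_no_common h1 h2 hg h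

/-- A closed zigzag that exists at every vertex of the triangle exists at `c` too. If its outer
vertices share an orbit, a diamond puts `c` into the orbit of `b`. Otherwise `eq_of_two_common`
collapses it, and `c` is in the orbit of `a`. -/
theorem nbr_of_tri {o a b c : A} (hoa : Fac G E o a) (hab : Fac G E a b) (hob : Fac G E o b)
    (hoc : Fac G E o c) : c ∈ MulAction.orbit G a ∨ c ∈ MulAction.orbit G b := by
  by_contra! hc
  let Z := Zigzag E (nbr E (MulAction.orbit G b)) (nbr E (MulAction.orbit G b))
    (nbr E (MulAction.orbit G o))
  have hbo := M.symm hob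
  have hba := M.symm hab
  have hao := M.symm hoa
  have hN : ∀ {x y z : A}, y ∈ MulAction.orbit G x → Fac G E z x →
      y ∈ nbr E (MulAction.orbit G z) := fun h1 h2 =>
    M.mem_nbr_orbit.2 ((fac_orbit_right h1).2 h2)
  have hZ : {c | Z c c} = Set.univ := by
    refine M.eq_univ (zigzag_def M.edge (M.nbr_orbit_def b) (M.nbr_orbit_def b)
      (M.nbr_orbit_def o)).diag (zigzag_inv M.inv (M.nbr_orbit_inv b) (M.nbr_orbit_inv b)
      (M.nbr_orbit_inv o)).diag (a := o) (b := a) (c := b) ?_ ?_ ?_ hoa hab hob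
    · obtain ⟨d, hd, h⟩ := hoa.out_orbit
      exact ⟨d, hN hd hba, o, M.mem_nbr_orbit.2 hbo, d, hN hd hoa, h, h, h, h⟩
    · obtain ⟨d, hd, h⟩ := hao.out_orbit
      obtain ⟨e, he, h'⟩ := hab.out_orbit
      exact ⟨d, hN hd hbo, a, M.mem_nbr_orbit.2 hba, e, hN he hob, h, h, h', h'⟩
    · obtain ⟨d, hd, h⟩ := hba.out_orbit
      obtain ⟨e, he, h'⟩ := M.in_orbit (show Fac G E d o from (fac_orbit_left M.inv hd).2 hao)
      exact ⟨d, hN hd hba, e, hN he hbo, d, hN hd hoa, h, h', h', h⟩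
  obtain ⟨u₁, h1, u₂, h2, u₃, h3, e1, e2, e3, e4⟩ : c ∈ {c | Z c c} := hZ ▸ Set.mem_univ c
  rw [M.mem_nbr_orbit] at h1 h2 h3
  by_cases hu : u₁ ∈ MulAction.orbit G u₃
  · have h4 : u₃ ∈ MulAction.orbit G a :=
      M.diamond_free hab hao (M.symm ((fac_orbit_right hu).1 h1)) (M.symm h3) hbo
    have h5 : Fac G E c a := (fac_orbit_right h4).1 (.of e4)
    exact hc.2 (M.diamond_free hbo hba (M.symm hoc) h5 hoa)
  · obtain rfl : c = u₂ := M.eq_of_two_common e4 e3 e1 e2 hu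
    exact hc.1 (M.diamond_free hab hao (M.symm h2) (M.symm hoc) hbo)

/-- The factor graph is a triangle, and every vertex has exactly one out-neighbour and exactly one
in-neighbour in each of the other two orbits. -/
theorem exists_coloring : ∃ col : A → ZMod 3, (∀ c, 𝒞.Def1 {a | col a = c}) ∧
    (∀ (g : G) a, col (g • a) = col a) ∧ (∀ a b, E a b → col a ≠ col b) ∧
    (∀ a c, c ≠ col a → ∃! b, col b = c ∧ E a b) ∧
    ∀ a c, c ≠ col a → ∃! b, col b = c ∧ E b a := by
  obtain ⟨o, p, q, hop, hpq, hoq⟩ := M.tri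
  let t : ZMod 3 → A := ![o, p, q]
  have ht : ∀ i j, i ≠ j → Fac G E (t i) (t j) := by
    intro i j hij
    fin_cases i <;> fin_cases j <;>
      first | exact absurd rfl hij | simp [t, hop, hpq, hoq, M.symm hop, M.symm hpq, M.symm hoq]
  have cover : ∀ x, ∃ i, x ∈ MulAction.orbit G (t i) := by
    intro x
    obtain ⟨z, h1, h2⟩ := M.exists_path o x
    rcases M.nbr_of_tri hop hpq hoq h1 with hz | hz
    · rcases M.nbr_of_tri (M.symm hop) hoq hpq ((fac_orbit_left M.inv hz).1 h2) with h | h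
      exacts [⟨0, h⟩, ⟨2, h⟩]
    · rcases M.nbr_of_tri (M.symm hoq) hop (M.symm hpq) ((fac_orbit_left M.inv hz).1 h2) with h | h
      exacts [⟨0, h⟩, ⟨1, h⟩]
  choose col hcol using cover
  have huniq : ∀ x i, x ∈ MulAction.orbit G (t i) ↔ col x = i := by
    intro x i
    constructor
    · intro h
      by_contra hne
      have := ht _ _ hne
      rw [← fac_orbit_left M.inv (hcol x), ← fac_orbit_right h] at this
      exact M.irrefl this
    · rintro rfl
      exact hcol x
  have hfac : ∀ x y, Fac G E x y ↔ col x ≠ col y := by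
    intro x y
    constructor
    · intro h he
      rw [fac_orbit_left M.inv (hcol x), fac_orbit_right (hcol y), he] at h
      exact M.irrefl h
    · intro h
      rw [fac_orbit_left M.inv (hcol x), fac_orbit_right (hcol y)]
      exact ht _ _ h
  refine ⟨col, fun c => ?_, fun g a => (huniq _ _).1 (inv1_orbit _ g (hcol a)),
    fun a b h => (hfac a b).1 (.of h), fun a c hc => ?_, fun a c hc => ?_⟩
  · have : {a | col a = c} = MulAction.orbit G (t c) := Set.ext fun x => (huniq x c).symm
    rw [this]
    exact M.orb _
  · have htc : col (t c) = c := (huniq _ _).1 (MulAction.mem_orbit_self _)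
    obtain ⟨b, hb, h⟩ := ((hfac a (t c)).2 (htc.symm ▸ hc.symm)).out_orbit
    refine ⟨b, ⟨(huniq _ _).1 hb, h⟩, fun b' ⟨h1, h2⟩ => (M.out_unique h h2 ?_).symm⟩
    rw [MulAction.orbit_eq_iff.2 hb]
    exact (huniq _ _).2 h1
  · have htc : col (t c) = c := (huniq _ _).1 (MulAction.mem_orbit_self _)
    obtain ⟨b, hb, h⟩ := M.in_orbit ((hfac a (t c)).2 (htc.symm ▸ hc.symm))
    refine ⟨b, ⟨(huniq _ _).1 hb, h⟩, fun b' ⟨h1, h2⟩ => (M.in_unique h h2 ?_).symm⟩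
    rw [MulAction.orbit_eq_iff.2 hb]
    exact (huniq _ _).2 h1

end MinimalGraph

end Minimal

/-! ### All Boolean relations from not-all-equal, and not-all-equal from inequality -/

namespace RelClone

section Boolean

variable {𝓑 : RelClone Bool} (hnae : 𝓑.Def fun x : Fin 3 → Bool => ¬ (x 0 = x 1 ∧ x 1 = x 2))
  {α : Type} [Finite α]
include hnae

theorem def_nae (i j k : α) : 𝓑.Def fun x : α → Bool => ¬ (x i = x j ∧ x j = x k) :=
  Def.reindex ![i, j, k] hnae

theorem def_nae_const (i j : α) (b : Bool) :
    𝓑.Def fun x : α → Bool => ¬ (x i = x j ∧ x j = b) := by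
  have : 𝓑.Def fun x : α → Bool => ∃ c, c ∈ ({b} : Set Bool) ∧ ¬ (x i = x j ∧ x j = c) :=
    Def.ex (P := fun x c => c ∈ ({b} : Set Bool) ∧ ¬ (x i = x j ∧ x j = c))
      (((def1_singleton b).app none).and (def_nae hnae (some i) (some j) none))
  exact this.congr fun x => by simp

theorem def_neq (i j : α) : 𝓑.Def fun x : α → Bool => x i ≠ x j :=
  (def_nae hnae i j j).congr fun x => by simp

theorem def_le (i j : α) : 𝓑.Def fun x : α → Bool => (x i = true → x j = true) := by
  have : 𝓑.Def fun x : α → Bool => ∃ c, c ≠ x i ∧ ¬ (c = x j ∧ x j = false) :=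
    Def.ex (P := fun x c => c ≠ x i ∧ ¬ (c = x j ∧ x j = false))
      ((def_neq hnae none (some i)).and (def_nae_const hnae none (some j) false))
  refine this.congr fun x => ?_
  generalize x i = a
  generalize x j = b
  revert a b
  decide

theorem def_or (i j k : α) : 𝓑.Def fun x : α → Bool => x k = (x i || x j) := by
  have h : 𝓑.Def fun x : α → Bool => ∃ t, ¬ (x i = x j ∧ x j = t) ∧ ¬ (t = x k ∧ x k = true) :=
    Def.ex (P := fun x t => ¬ (x i = x j ∧ x j = t) ∧ ¬ (t = x k ∧ x k = true))
      ((def_nae hnae (some i) (some j) none).and (def_nae_const hnae none (some k) true))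
  refine (h.and ((def_le hnae i k).and (def_le hnae j k))).congr fun x => ?_
  generalize x i = a
  generalize x j = b
  generalize x k = c
  revert a b c
  decide

/-- `P` is the conjunction of the clauses `x ≠ y` over all `y` outside `P`. The truth value of a
clause is assembled literal by literal with `def_or`. -/
theorem def_of_nae (P : (α → Bool) → Prop) : 𝓑.Def P := by
  classical
  have clause : ∀ (y : α → Bool) (s : Finset α),
      𝓑.Def fun x : Option α → Bool => x none = decide (∃ i ∈ s, x (some i) ≠ y i) := by
    intro y s
    induction s using Finset.induction_on with
    | empty => exact ((def1_singleton false).app none).congr fun x => by simp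
    | insert j s _ ih =>
      have lit : 𝓑.Def fun x : Option α → Bool => x none = decide (x (some j) ≠ y j) := by
        cases hy : y j
        · exact (def2_eq.app none (some j)).congr fun x => by simp
        · exact (def_neq hnae none (some j)).congr fun x => by simp [Bool.eq_not]
      have : 𝓑.Def fun x : Option α → Bool => ∃ u v, (u = decide (x (some j) ≠ y j) ∧
          v = decide (∃ i ∈ s, x (some i) ≠ y i)) ∧ x none = (u || v) := by
        refine Def.ex (P := fun x u => ∃ v, (u = decide (x (some j) ≠ y j) ∧
          v = decide (∃ i ∈ s, x (some i) ≠ y i)) ∧ x none = (u || v)) ?_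
        refine Def.ex (P := fun (x : Option (Option α) → Bool) v =>
          (x none = decide (x (some (some j)) ≠ y j) ∧
          v = decide (∃ i ∈ s, x (some (some i)) ≠ y i)) ∧ x (some none) = (x none || v)) ?_
        exact ((lit.reindex (fun o => o.elim (some none) fun i => some (some (some i)))).and
          (ih.reindex (fun o => o.elim none fun i => some (some (some i))))).and
          (def_or hnae (some none) none (some (some none)))
      refine this.congr fun x => ?_
      simp only [Finset.mem_insert, exists_eq_or_imp]
      constructor
      · rintro ⟨u, v, ⟨rfl, rfl⟩, h⟩
        rw [h, Bool.decide_or]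
      · intro h
        exact ⟨_, _, ⟨rfl, rfl⟩, by rw [h, Bool.decide_or]⟩
  have := Fintype.ofFinite α
  have avoid : ∀ y : α → Bool, 𝓑.Def fun x => x ≠ y := by
    intro y
    have : 𝓑.Def fun x : α → Bool => ∃ c, c ∈ ({true} : Set Bool) ∧
        c = decide (∃ i ∈ Finset.univ, x i ≠ y i) :=
      Def.ex (P := fun x c => c ∈ ({true} : Set Bool) ∧
        c = decide (∃ i ∈ Finset.univ, x i ≠ y i))
        (((def1_singleton true).app none).and ((clause y Finset.univ).congr fun x => by simp))
    refine this.congr fun x => ?_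
    simp [funext_iff]
  refine (Def.all fun y : {y // ¬ P y} => avoid y).congr fun x => ?_
  constructor
  · intro h
    by_contra hP
    exact h ⟨x, hP⟩ rfl
  · rintro h ⟨y, hy⟩ rfl
    exact hy h

end Boolean

/-- A clone containing a relation that behaves like the inequality relation on at least three
elements is hard. -/
theorem hard_of_neq {A : Type u} {𝒞 : RelClone A} {ι : Type} [Finite ι] {x y : ι → A}
    (hy : Function.Injective y) {R : A → A → Prop} (hR : 𝒞.Def2 R)
    (h1 : ∀ k b, R (x k) b ↔ ∃ l, l ≠ k ∧ b = y l) (h2 : ∀ l a, R a (y l) ↔ ∃ k, k ≠ l ∧ a = x k)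
    {i₀ i₁ i₂ : ι} (h01 : i₀ ≠ i₁) (h02 : i₀ ≠ i₂) (h12 : i₁ ≠ i₂) : 𝒞.Hard := by
  have hRxy : ∀ k l, R (x k) (y l) ↔ l ≠ k := by
    intro k l
    rw [h1]
    exact ⟨fun ⟨l', h, e⟩ => hy e ▸ h, fun h => ⟨l, h, rfl⟩⟩
  let D (i j : ι) (b : Bool) : A := bif b then y j else y i
  have pair : ∀ i j k : ι, k ≠ i → k ≠ j → 𝒞.Def1 {a | ∃ b, a = D i j b} := by
    intro i j k hki hkj
    have : 𝒞.Def1 {a | ∀ k, k ≠ i → k ≠ j → R (x k) a} :=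
      Def.all fun k => Def.imp fun _ => Def.imp fun _ => hR.left (x k)
    convert this using 1
    ext a
    constructor
    · rintro ⟨_ | _, rfl⟩ k hi hj
      · exact (hRxy _ _).2 hi.symm
      · exact (hRxy _ _).2 hj.symm
    · intro h
      obtain ⟨l, hl, rfl⟩ := (h1 _ _).1 (h k hki hkj)
      by_cases hli : l = i
      · exact ⟨false, hli ▸ rfl⟩
      by_cases hlj : l = j
      · exact ⟨true, hlj ▸ rfl⟩
      exact absurd rfl ((hRxy _ _).1 (h l hli hlj))
  have d0 := pair i₀ i₁ i₂ h02.symm h12.symm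
  have d1 := pair i₁ i₂ i₀ h01 h02
  have d2 := pair i₂ i₀ i₁ h12 h01.symm
  -- The conditions on the other `y l` force `v` to be one of `x i₀`, `x i₁`, `x i₂`, so on the
  -- `y`'s `J` says that one of these three indices is missed by all arguments.
  let J (a b c : A) : Prop :=
    ∃ v, (R v a ∧ R v b ∧ R v c) ∧ ∀ l, l ≠ i₀ ∧ l ≠ i₁ ∧ l ≠ i₂ → R v (y l)
  have hJ : ∀ {α : Type} [Finite α] (i j k : α), 𝒞.Def fun z => J (z i) (z j) (z k) := by
    intro α _ i j k
    refine Def.ex (P := fun z v => (R v (z i) ∧ R v (z j) ∧ R v (z k)) ∧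
      ∀ l, l ≠ i₀ ∧ l ≠ i₁ ∧ l ≠ i₂ → R v (y l)) ?_
    refine ((hR.app _ _).and ((hR.app _ _).and (hR.app _ _))).and
      (Def.all fun l => Def.imp fun _ => ?_)
    exact (hR.flip.left (y l)).app none
  have Jy : ∀ i j k, J (y i) (y j) (y k) ↔
      (i ≠ i₀ ∧ j ≠ i₀ ∧ k ≠ i₀) ∨ (i ≠ i₁ ∧ j ≠ i₁ ∧ k ≠ i₁) ∨ (i ≠ i₂ ∧ j ≠ i₂ ∧ k ≠ i₂) := by
    intro i j k
    constructor
    · rintro ⟨v, ⟨hi, hj, hk⟩, hl⟩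
      obtain ⟨n, -, rfl⟩ := (h2 _ _).1 hi
      simp only [hRxy] at hi hj hk hl
      by_cases n0 : n = i₀
      · subst n0; exact Or.inl ⟨hi, hj, hk⟩
      by_cases n1 : n = i₁
      · subst n1; exact Or.inr (Or.inl ⟨hi, hj, hk⟩)
      by_cases n2 : n = i₂
      · subst n2; exact Or.inr (Or.inr ⟨hi, hj, hk⟩)
      exact absurd rfl (hl n ⟨n0, n1, n2⟩)
    · simp only [J]
      rintro (h | h | h)
      · exact ⟨x i₀, by simpa only [hRxy] using h, fun l hl => (hRxy _ _).2 hl.1⟩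
      · exact ⟨x i₁, by simpa only [hRxy] using h, fun l hl => (hRxy _ _).2 hl.2.1⟩
      · exact ⟨x i₂, by simpa only [hRxy] using h, fun l hl => (hRxy _ _).2 hl.2.2⟩
  -- On the cyclically arranged pairs, three choices exhaust the three indices exactly when all
  -- three Booleans agree.
  have JD : ∀ p q r, J (D i₀ i₁ p) (D i₁ i₂ q) (D i₂ i₀ r) ↔ ¬ (p = q ∧ q = r) := by
    have h10 := h01.symm
    have h20 := h02.symm
    have h21 := h12.symm
    rintro (_ | _) (_ | _) (_ | _) <;> simp [D, *]
  let Q (a b c : A) : Prop := (∃ p, a = D i₀ i₁ p) ∧ (∃ q, b = D i₁ i₂ q) ∧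
    (∃ r, c = D i₂ i₀ r) ∧ J a b c
  have hQ : ∀ {α : Type} [Finite α] (i j k : α), 𝒞.Def fun z => Q (z i) (z j) (z k) :=
    fun i j k => (d0.app i).and ((d1.app j).and ((d2.app k).and (hJ i j k)))
  have Qiff : ∀ a b c, Q a b c ↔ ∃ p q r, a = D i₀ i₁ p ∧ b = D i₁ i₂ q ∧ c = D i₂ i₀ r ∧
      ¬ (p = q ∧ q = r) := by
    intro a b c
    constructor
    · rintro ⟨⟨p, rfl⟩, ⟨q, rfl⟩, ⟨r, rfl⟩, h⟩
      exact ⟨p, q, r, rfl, rfl, rfl, (JD _ _ _).1 h⟩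
    · rintro ⟨p, q, r, rfl, rfl, rfl, h⟩
      exact ⟨⟨p, rfl⟩, ⟨q, rfl⟩, ⟨r, rfl⟩, (JD _ _ _).2 h⟩
  have inj : ∀ {i j}, i ≠ j → ∀ {b c}, D i j b = D i j c → b = c := by
    rintro i j hij (_ | _) (_ | _) h
    · rfl
    · exact absurd (hy h) hij
    · exact absurd (hy h).symm hij
    · rfl
  have inj0 : ∀ b c, D i₀ i₁ b = D i₀ i₁ c ↔ b = c := fun b c => ⟨inj h01, congrArg _⟩
  have inj1 : ∀ b c, D i₁ i₂ b = D i₁ i₂ c ↔ b = c := fun b c => ⟨inj h12, congrArg _⟩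
  have inj2 : ∀ b c, D i₂ i₀ b = D i₂ i₀ c ↔ b = c := fun b c => ⟨inj h02.symm, congrArg _⟩
  have param : ∀ {α : Type} [Finite α] {P : (α → A) → A → Prop} (a : A),
      𝒞.Def (fun z : Option α → A => P (fun i => z (some i)) (z none)) → 𝒞.Def fun z => P z a := by
    intro α _ P a hP
    exact (Def.ex (P := fun z c => c ∈ ({a} : Set A) ∧ P z c)
      (((def1_singleton a).app none).and hP)).congr fun z => by simp
  -- Fixing the remaining argument of not-all-equal to both of its values leaves inequality.
  -- Composing two inequalities gives the equalities that bring the three pairs back to a single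
  -- copy of the Booleans.
  have neq01 : 𝒞.Def2 fun a b => ∃ p q, a = D i₀ i₁ p ∧ b = D i₁ i₂ q ∧ p ≠ q := by
    refine Def.congr ((param (P := fun z c => Q (z false) (z true) c) (D i₂ i₀ false)
      (hQ (some false) (some true) none)).and
      (param (P := fun z c => Q (z false) (z true) c) (D i₂ i₀ true)
      (hQ (some false) (some true) none))) fun z => ?_
    simp only [Qiff, inj2]
    constructor
    · rintro ⟨⟨p, q, r, hp, hq, rfl, h⟩, ⟨p', q', r', hp', hq', rfl, h'⟩⟩
      obtain rfl := (inj0 _ _).1 (hp ▸ hp')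
      obtain rfl := (inj1 _ _).1 (hq ▸ hq')
      refine ⟨p, q, hp, hq, ?_⟩
      exact (by decide : ∀ p q : Bool, ¬ (p = q ∧ q = false) → ¬ (p = q ∧ q = true) → p ≠ q) p q h h'
    · rintro ⟨p, q, hp, hq, h⟩
      exact ⟨⟨p, q, _, hp, hq, rfl, fun h' => h h'.1⟩, ⟨p, q, _, hp, hq, rfl, fun h' => h h'.1⟩⟩
  have neq02 : 𝒞.Def2 fun a c => ∃ p r, a = D i₀ i₁ p ∧ c = D i₂ i₀ r ∧ p ≠ r := by
    refine Def.congr ((param (P := fun z b => Q (z false) b (z true)) (D i₁ i₂ false)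
      (hQ (some false) none (some true))).and
      (param (P := fun z b => Q (z false) b (z true)) (D i₁ i₂ true)
      (hQ (some false) none (some true)))) fun z => ?_
    simp only [Qiff, inj1]
    constructor
    · rintro ⟨⟨p, q, r, hp, rfl, hq, h⟩, ⟨p', q', r', hp', rfl, hq', h'⟩⟩
      obtain rfl := (inj0 _ _).1 (hp ▸ hp')
      obtain rfl := (inj2 _ _).1 (hq ▸ hq')
      refine ⟨p, r, hp, hq, ?_⟩
      exact (by decide : ∀ p r : Bool, ¬ (p = false ∧ false = r) → ¬ (p = true ∧ true = r) → p ≠ r)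
        p r h h'
    · rintro ⟨p, q, hp, hq, h⟩
      exact ⟨⟨p, _, q, hp, rfl, hq, fun h' => h (h'.1.trans h'.2)⟩,
        ⟨p, _, q, hp, rfl, hq, fun h' => h (h'.1.trans h'.2)⟩⟩
  have neq12 : 𝒞.Def2 fun b c => ∃ q r, b = D i₁ i₂ q ∧ c = D i₂ i₀ r ∧ q ≠ r := by
    refine Def.congr ((param (P := fun z a => Q a (z false) (z true)) (D i₀ i₁ false)
      (hQ none (some false) (some true))).and
      (param (P := fun z a => Q a (z false) (z true)) (D i₀ i₁ true)
      (hQ none (some false) (some true)))) fun z => ?_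
    simp only [Qiff, inj0]
    constructor
    · rintro ⟨⟨p, q, r, rfl, hp, hq, h⟩, ⟨p', q', r', rfl, hp', hq', h'⟩⟩
      obtain rfl := (inj1 _ _).1 (hp ▸ hp')
      obtain rfl := (inj2 _ _).1 (hq ▸ hq')
      refine ⟨q, r, hp, hq, ?_⟩
      exact (by decide : ∀ q r : Bool, ¬ (false = q ∧ q = r) → ¬ (true = q ∧ q = r) → q ≠ r) q r h h'
    · rintro ⟨p, q, hp, hq, h⟩
      exact ⟨⟨_, p, q, rfl, hp, hq, fun h' => h h'.2⟩, ⟨_, p, q, rfl, hp, hq, fun h' => h h'.2⟩⟩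
  have eq01 : 𝒞.Def2 fun a b => ∃ p, a = D i₀ i₁ p ∧ b = D i₁ i₂ p := by
    refine Def.congr (neq02.comp neq12.flip) fun z => ?_
    constructor
    · rintro ⟨c, ⟨p, r, h1, rfl, h3⟩, ⟨q, r', h4, h5, h6⟩⟩
      obtain rfl := (inj2 _ _).1 h5
      obtain rfl : p = q := (by decide : ∀ p q r : Bool, p ≠ r → q ≠ r → p = q) p q r h3 h6
      exact ⟨p, h1, h4⟩
    · rintro ⟨p, h1, h2⟩
      exact ⟨D i₂ i₀ !p, ⟨p, !p, h1, rfl, by simp⟩, ⟨p, !p, h2, rfl, by simp⟩⟩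
  have eq02 : 𝒞.Def2 fun a c => ∃ p, a = D i₀ i₁ p ∧ c = D i₂ i₀ p := by
    refine Def.congr (neq01.comp neq12) fun z => ?_
    constructor
    · rintro ⟨c, ⟨p, r, h1, rfl, h3⟩, ⟨r', q, h5, h4, h6⟩⟩
      obtain rfl := (inj1 _ _).1 h5
      obtain rfl : p = q := (by decide : ∀ p q r : Bool, p ≠ r → r ≠ q → p = q) p q r h3 h6
      exact ⟨p, h1, h4⟩
    · rintro ⟨p, h1, h2⟩
      exact ⟨D i₁ i₂ !p, ⟨p, !p, h1, rfl, by simp⟩, ⟨!p, p, rfl, h2, by simp⟩⟩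
  have H : 𝒞.IsInterp fun a b => a = D i₀ i₁ b := by
    refine ⟨fun {a b b'} h h' => (inj0 _ _).1 (h ▸ h'), fun b => ⟨_, rfl⟩, d0, ?_⟩
    refine Def.congr (Def.and 𝒞.eq' (Def1.app (α := Bool) d0 false)) fun z => ?_
    constructor
    · rintro ⟨h, b, hb⟩
      exact ⟨b, hb, h ▸ hb⟩
    · rintro ⟨b, h, h'⟩
      exact ⟨h.trans h'.symm, b, h⟩
  refine ⟨fun a b => a = D i₀ i₁ b, H.func, H.surj, fun {α} _ P =>
    def_of_nae (𝓑 := 𝒞.interp H) ?_ P⟩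
  have : 𝒞.Def fun z : Fin 3 → A => ∃ b, ∃ c, (∃ p, z 1 = D i₀ i₁ p ∧ b = D i₁ i₂ p) ∧
      (∃ p, z 2 = D i₀ i₁ p ∧ c = D i₂ i₀ p) ∧ Q (z 0) b c := by
    refine Def.ex (P := fun z b => ∃ c, (∃ p, z 1 = D i₀ i₁ p ∧ b = D i₁ i₂ p) ∧
      (∃ p, z 2 = D i₀ i₁ p ∧ c = D i₂ i₀ p) ∧ Q (z 0) b c) ?_
    refine Def.ex (P := fun z c => (∃ p, z (some 1) = D i₀ i₁ p ∧ z none = D i₁ i₂ p) ∧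
      (∃ p, z (some 2) = D i₀ i₁ p ∧ c = D i₂ i₀ p) ∧ Q (z (some 0)) (z none) c) ?_
    exact (eq01.app (some (some 1)) (some none)).and
      ((eq02.app (some (some 2)) none).and (hQ (some (some 0)) (some none) none))
  refine Def.congr (𝒞 := 𝒞) this fun z => ?_
  simp only [Qiff]
  constructor
  · rintro ⟨b, c, ⟨q, hq, rfl⟩, ⟨r, hr, rfl⟩, p, q', r', hp, hq', hr', h⟩
    obtain rfl := (inj1 _ _).1 hq'
    obtain rfl := (inj2 _ _).1 hr'
    refine ⟨![p, q, r], fun i => ?_, h⟩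
    fin_cases i
    exacts [hp, hq, hr]
  · rintro ⟨t, ht, h⟩
    exact ⟨_, _, ⟨t 1, ht 1, rfl⟩, ⟨t 2, ht 2, rfl⟩, t 0, t 1, t 2, ht 0, rfl, rfl, h⟩

end RelClone

/-! ### Inequality from walks around a cycle -/

namespace RelClone

variable {A : Type u} {𝒞 : RelClone A}

/-- The composition of the first `n` relations of a sequence. -/
def compSeq (s : ℕ → A → A → Prop) : ℕ → A → A → Prop
  | 0 => fun a b => a = b
  | n + 1 => Relation.Comp (compSeq s n) (s n)

theorem compSeq_def {s : ℕ → A → A → Prop} (hs : ∀ n, 𝒞.Def2 (s n)) (n : ℕ) :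
    𝒞.Def2 (compSeq s n) := by
  induction n with
  | zero => exact def2_eq
  | succ n ih => exact ih.comp (hs n)

/-- A clone containing a sequence of relations which walk around a cycle of length at least three
in both directions is hard. -/
theorem hard_of_cycle {s : ℕ → A → A → Prop} (hs : ∀ n, 𝒞.Def2 (s n)) {z : ℕ → ℤ → A} {m : ℕ}
    (hm : 3 ≤ m) (hz : ∀ n k l, z n k = z n l ↔ (m : ℤ) ∣ k - l)
    (h1 : ∀ n l b, s n (z n l) b ↔ b = z (n + 1) l ∨ b = z (n + 1) (l - 1))
    (h2 : ∀ n l a, s n a (z (n + 1) l) ↔ a = z n l ∨ a = z n (l + 1)) : 𝒞.Hard := by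
  have w1 : ∀ n k b, compSeq s n (z 0 k) b ↔ ∃ j : ℤ, 0 ≤ j ∧ j ≤ n ∧ b = z n (k - j) := by
    intro n
    induction n with
    | zero =>
      intro k b
      constructor
      · rintro rfl
        exact ⟨0, le_rfl, by simp, by simp⟩
      · rintro ⟨j, hj, hj', rfl⟩
        obtain rfl : j = 0 := by push_cast at hj'; omega
        simp [compSeq]
    | succ n ih =>
      intro k b
      constructor
      · rintro ⟨c, hc, hcb⟩
        obtain ⟨j, hj, hj', rfl⟩ := (ih k c).1 hc
        rcases (h1 _ _ _).1 hcb with rfl | rfl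
        · exact ⟨j, hj, by push_cast; omega, rfl⟩
        · exact ⟨j + 1, by omega, by push_cast; omega, by congr 1; ring⟩
      · rintro ⟨j, hj, hj', rfl⟩
        push_cast at hj'
        rcases eq_or_lt_of_le hj with rfl | hj0
        · exact ⟨z n k, (ih _ _).2 ⟨0, le_rfl, by omega, by simp⟩, (h1 _ _ _).2 (Or.inl (by simp))⟩
        · exact ⟨z n (k - (j - 1)), (ih _ _).2 ⟨j - 1, by omega, by omega, rfl⟩,
            (h1 _ _ _).2 (Or.inr (by congr 1; ring))⟩
  have w2 : ∀ n l a, compSeq s n a (z n l) ↔ ∃ j : ℤ, 0 ≤ j ∧ j ≤ n ∧ a = z 0 (l + j) := by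
    intro n
    induction n with
    | zero =>
      intro l a
      constructor
      · rintro rfl
        exact ⟨0, le_rfl, by simp, by simp⟩
      · rintro ⟨j, hj, hj', rfl⟩
        obtain rfl : j = 0 := by push_cast at hj'; omega
        simp [compSeq]
    | succ n ih =>
      intro l a
      constructor
      · rintro ⟨c, hc, hcb⟩
        rcases (h2 _ _ _).1 hcb with rfl | rfl
        · obtain ⟨j, hj, hj', rfl⟩ := (ih _ _).1 hc
          exact ⟨j, hj, by push_cast; omega, rfl⟩
        · obtain ⟨j, hj, hj', rfl⟩ := (ih _ _).1 hc
          exact ⟨j + 1, by omega, by push_cast; omega, by congr 1; ring⟩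
      · rintro ⟨j, hj, hj', rfl⟩
        push_cast at hj'
        rcases eq_or_lt_of_le hj with rfl | hj0
        · exact ⟨z n l, (ih _ _).2 ⟨0, le_rfl, by omega, by simp⟩, (h2 _ _ _).2 (Or.inl rfl)⟩
        · exact ⟨z n (l + 1), (ih _ _).2 ⟨j - 1, by omega, by omega, by congr 1; ring⟩,
            (h2 _ _ _).2 (Or.inr rfl)⟩
  have hm0 : (0 : ℤ) < m := by omega
  have hn : ((m - 2 : ℕ) : ℤ) = m - 2 := by omega
  have toFin : ∀ k : ℤ, ∃ i : Fin m, (m : ℤ) ∣ k - (i : ℤ) := by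
    intro k
    refine ⟨⟨(k % m).toNat, by have := Int.emod_lt_of_pos k hm0; omega⟩, ?_⟩
    simp only [Int.toNat_of_nonneg (Int.emod_nonneg k hm0.ne')]
    exact Int.dvd_self_sub_emod
  have small : ∀ k : ℤ, 0 < k → k < m → ¬ (m : ℤ) ∣ k := fun k h0 h1 hd =>
    absurd (Int.le_of_dvd h0 hd) (by omega)
  have finEq : ∀ i j : Fin m, (m : ℤ) ∣ (i : ℤ) - j → i = j := by
    intro i j hd
    have hi := i.2
    have hj := j.2
    by_contra hne
    have hne' : (i : ℕ) ≠ j := fun h => hne (Fin.ext h)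
    rcases lt_or_gt_of_ne hne' with h | h
    · exact small ((j : ℤ) - i) (by omega) (by omega) (by simpa using (Int.dvd_neg.2 hd))
    · exact small ((i : ℤ) - j) (by omega) (by omega) hd
  -- After `m - 2` steps from index `k`, the indices `k, k - 1, …, k - (m - 2)` are reached, that
  -- is, all except `k + 1` modulo `m`. Hence the shift by one in `y`.
  refine hard_of_neq (ι := Fin m) (x := fun i => z 0 i) (y := fun i => z (m - 2) (i + 1))
    (R := compSeq s (m - 2)) ?_ (compSeq_def hs _) ?_ ?_ (i₀ := ⟨0, by omega⟩)
    (i₁ := ⟨1, by omega⟩) (i₂ := ⟨2, by omega⟩) (by simp) (by simp) (by simp)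
  · intro i j hij
    exact finEq i j (by simpa using (hz _ _ _).1 hij)
  · intro k b
    rw [w1, hn]
    constructor
    · rintro ⟨j, hj, hj', rfl⟩
      obtain ⟨l, hl⟩ := toFin (k - j - 1)
      refine ⟨l, ?_, (hz _ _ _).2 (by convert hl using 1; ring)⟩
      rintro rfl
      refine small (j + 1) (by omega) (by omega) ?_
      rw [← Int.dvd_neg]
      convert hl using 1
      ring
    · rintro ⟨l, hl, rfl⟩
      obtain ⟨j, hj⟩ := toFin (k - l - 1)
      have hjm := j.2
      refine ⟨j, by omega, ?_, (hz _ _ _).2 ?_⟩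
      · by_contra hlt
        have : (j : ℤ) = m - 1 := by omega
        refine hl (finEq _ _ ?_)
        rw [this] at hj
        have h3 := Int.dvd_neg.2 (Int.dvd_add hj (dvd_refl (m : ℤ)))
        convert h3 using 1
        ring
      · rw [← Int.dvd_neg]
        convert hj using 1
        ring
  · intro l a
    rw [w2, hn]
    constructor
    · rintro ⟨j, hj, hj', rfl⟩
      obtain ⟨k, hk⟩ := toFin (l + 1 + j)
      refine ⟨k, ?_, (hz _ _ _).2 hk⟩
      rintro rfl
      refine small (j + 1) (by omega) (by omega) ?_
      convert hk using 1
      ring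
    · rintro ⟨k, hk, rfl⟩
      obtain ⟨j, hj⟩ := toFin (k - l - 1)
      have hjm := j.2
      refine ⟨j, by omega, ?_, (hz _ _ _).2 ?_⟩
      · by_contra hlt
        have : (j : ℤ) = m - 1 := by omega
        refine hk (finEq _ _ ?_)
        rw [this] at hj
        have h3 := Int.dvd_add hj (dvd_refl (m : ℤ))
        convert h3 using 1
        ring
      · convert hj using 1
        ring

/-- A definable digraph which is the union of the graph of a permutation `f` and the inverse of the
graph of a permutation `h`, where `f` and `h` rotate the colours of a 3-colouring, is hard. -/
theorem hard_of_perm {E : A → A → Prop} (hE : 𝒞.Def2 E) (f h : Equiv.Perm A)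
    (hfh : ∀ a b, E a b ↔ b = f a ∨ a = h b) {col : A → ZMod 3} (hf : ∀ a, col (f a) = col a + 1)
    (hh : ∀ a, col (h a) = col a + 1) {c : A} {n : ℕ} (hn : 0 < n) (hc : ((h * f) ^ n) c = c) :
    𝒞.Hard := by
  set τ := h * f with hτ
  let x (k : ℤ) : A := (τ ^ k) c
  have hx1 : ∀ k, x (k + 1) = h (f (x k)) := fun k => by
    simp only [x]
    rw [add_comm, zpow_one_add, Equiv.Perm.mul_apply, hτ, Equiv.Perm.mul_apply]
  let m := MulAction.period τ c
  have hxx : ∀ k l, x k = x l ↔ (m : ℤ) ∣ k - l := by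
    intro k l
    rw [← MulAction.zpow_smul_eq_iff_period_dvd, sub_eq_neg_add, zpow_add, zpow_neg, mul_smul,
      inv_smul_eq_iff]
    rfl
  -- One application of `τ` adds 2 to the colour and two applications add 4, neither of which is 0
  -- modulo 3.
  have hm : 3 ≤ m := by
    have h0 : x n = x 0 := by simpa [x] using hc
    have h1 : x 1 ≠ x 0 := fun h => by
      have := congrArg col h
      rw [← zero_add (1 : ℤ), hx1, hh, hf, add_assoc] at this
      simp at this
      revert this
      decide
    have h2 : x 2 ≠ x 0 := fun h => by
      have := congrArg col h
      rw [← one_add_one_eq_two, hx1, hh, hf, ← zero_add (1 : ℤ), hx1, hh, hf, add_assoc, add_assoc,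
        add_assoc] at this
      simp at this
      revert this
      decide
    rw [hxx] at h0
    rw [Ne, hxx] at h1 h2
    have hm0 : m ≠ 0 := by
      intro h
      rw [h] at h0
      simp at h0
      omega
    have hm1 : m ≠ 1 := by
      intro h
      rw [h] at h1
      simp at h1
    have hm2 : m ≠ 2 := by
      intro h
      rw [h] at h2
      simp at h2
    omega
  let y (k : ℤ) : A := f (x k)
  have e1 : ∀ k b, E (x k) b ↔ b = y k ∨ b = y (k - 1) := by
    intro k b
    rw [hfh]
    refine or_congr Iff.rfl ?_
    rw [show x k = h (y (k - 1)) by simpa using hx1 (k - 1), h.injective.eq_iff, eq_comm]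
  have e2 : ∀ k a, E a (y k) ↔ a = x k ∨ a = x (k + 1) := by
    intro k a
    rw [hfh, hx1]
    exact or_congr (by rw [f.injective.eq_iff, eq_comm]) Iff.rfl
  -- `E` and its inverse alternate between the `x`'s and the `y`'s. The offset `n / 2` re-centres
  -- the indices so that every step goes to `l` or `l - 1`.
  refine hard_of_cycle (s := fun n => if Even n then E else fun a b => E b a)
    (z := fun n l => if Even n then x (l + (n / 2 : ℕ)) else y (l + (n / 2 : ℕ))) (m := m) ?_ hm
    ?_ ?_ ?_
  · intro n
    by_cases hn : Even n
    · simpa [hn] using hE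
    · simpa [hn] using hE.flip
  · intro n k l
    by_cases hn : Even n
    · simp [hn, hxx]
    · simp [hn, y, hxx]
  · intro n l b
    by_cases hn : Even n
    · have h1 : ((n + 1) / 2 : ℕ) = n / 2 := by obtain ⟨p, rfl⟩ := hn; omega
      simp only [hn, if_true, Nat.even_add_one, not_true, if_false, e1, h1]
      rw [add_sub_right_comm]
    · have h1 : ((n + 1) / 2 : ℕ) = n / 2 + 1 := by
        rw [Nat.not_even_iff_odd] at hn; obtain ⟨p, rfl⟩ := hn; omega
      simp only [hn, if_false, Nat.even_add_one, not_false_eq_true, if_true, e2, h1]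
      rw [or_comm]
      push_cast
      refine or_congr ?_ ?_ <;> (refine Eq.congr rfl (congrArg x ?_); ring)
  · intro n l a
    by_cases hn : Even n
    · have h1 : ((n + 1) / 2 : ℕ) = n / 2 := by obtain ⟨p, rfl⟩ := hn; omega
      simp only [hn, if_true, Nat.even_add_one, not_true, if_false, e2, h1]
      rw [add_right_comm]
    · have h1 : ((n + 1) / 2 : ℕ) = n / 2 + 1 := by
        rw [Nat.not_even_iff_odd] at hn; obtain ⟨p, rfl⟩ := hn; omega
      simp only [hn, if_false, Nat.even_add_one, not_false_eq_true, if_true, e1, h1]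
      rw [or_comm]
      push_cast
      refine or_congr ?_ ?_ <;> (refine Eq.congr rfl (congrArg y ?_); ring)

end RelClone

/-! ### Minimal graphs are hard -/

section Minimal

variable {G : Type v} [Group G] {A : Type u} [MulAction G A]
  [Finite (MulAction.orbitRel.Quotient G (A × A))]

/-- Two pairs `(c, τ ^ k c)` and `(c, τ ^ l c)` lie in one orbit. The group element matching them
fixes `c` and commutes with `τ`, so it also fixes `τ ^ l c`. -/
theorem exists_period {τ : Equiv.Perm A} (hτ : ∀ (g : G) a, τ (g • a) = g • τ a) (c : A) :
    ∃ n, 0 < n ∧ (τ ^ n) c = c := by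
  have hpow : ∀ (n : ℕ) (g : G) a, (τ ^ n) (g • a) = g • (τ ^ n) a := by
    intro n g
    induction n with
    | zero => simp
    | succ n ih => intro a; rw [pow_succ, Equiv.Perm.mul_apply, Equiv.Perm.mul_apply, hτ, ih]
  obtain ⟨k, l, hkl, h⟩ := Finite.exists_ne_map_eq_of_infinite fun n : ℕ =>
    (Quotient.mk _ (c, (τ ^ n) c) : MulAction.orbitRel.Quotient G (A × A))
  wlog hlt : k < l generalizing k l
  · exact this l k hkl.symm h.symm (by omega)
  obtain ⟨g, hg⟩ := Quotient.exact h
  have h1 : g • c = c := congrArg Prod.fst hg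
  have h2 : g • (τ ^ l) c = (τ ^ k) c := congrArg Prod.snd hg
  rw [← hpow, h1] at h2
  refine ⟨l - k, by omega, (τ ^ k).injective ?_⟩
  rw [← Equiv.Perm.mul_apply, ← pow_add, Nat.add_sub_cancel' hlt.le, h2]

theorem MinimalGraph.hard {𝒞 : RelClone A} {E : A → A → Prop} (M : MinimalGraph G 𝒞 E) :
    𝒞.Hard := by
  obtain ⟨col, -, hG, hne, hout, hin⟩ := M.exists_coloring
  have ne1 : ∀ t : ZMod 3, t + 1 ≠ t := by decide
  have ne2 : ∀ t : ZMod 3, t - 1 ≠ t := by decide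
  choose f hf hf' using fun a => hout a (col a + 1) (ne1 _)
  choose f' hg hg' using fun a => hin a (col a - 1) (ne2 _)
  choose h hh hh' using fun a => hin a (col a + 1) (ne1 _)
  choose h' hk hk' using fun a => hout a (col a - 1) (ne2 _)
  -- `F` follows edges forwards and `H` follows them backwards, both raising the colour by one.
  -- Their inverses are the other two choices of unique neighbours.
  let F : Equiv.Perm A := ⟨f, f', fun a => (hg' _ _ ⟨by rw [(hf a).1]; ring, (hf a).2⟩).symm,
    fun a => (hf' _ _ ⟨by rw [(hg a).1]; ring, (hg a).2⟩).symm⟩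
  let H : Equiv.Perm A := ⟨h, h', fun a => (hk' _ _ ⟨by rw [(hh a).1]; ring, (hh a).2⟩).symm,
    fun a => (hh' _ _ ⟨by rw [(hk a).1]; ring, (hk a).2⟩).symm⟩
  have hFG : ∀ (g : G) a, F (g • a) = g • F a := fun g a =>
    (hf' _ _ ⟨by rw [hG, hG]; exact (hf a).1, M.inv g (hf a).2⟩).symm
  have hHG : ∀ (g : G) a, H (g • a) = g • H a := fun g a =>
    (hh' _ _ ⟨by rw [hG, hG]; exact (hh a).1, M.inv g (hh a).2⟩).symm
  obtain ⟨c, -⟩ := M.tri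
  obtain ⟨n, hn, hc⟩ := exists_period (G := G) (τ := H * F)
    (fun g a => by simp [Equiv.Perm.mul_apply, hFG, hHG]) c
  refine RelClone.hard_of_perm M.edge F H (fun a b => ?_) (col := col) (fun a => (hf a).1)
    (fun a => (hh a).1) hn hc
  constructor
  · intro e
    rcases (by decide : ∀ s t : ZMod 3, s ≠ t → t = s + 1 ∨ s = t + 1) _ _ (hne a b e) with h1 | h1
    · exact Or.inl (hf' _ _ ⟨h1, e⟩)
    · exact Or.inr (hh' _ _ ⟨h1, e⟩)
  · rintro (rfl | rfl)
    exacts [(hf a).2, (hh b).2]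

end Minimal

/-! ### Passing to subsets and quotients -/

section Transfer

variable {G : Type v} [Group G] {A : Type u} [MulAction G A] {B : Type w} [MulAction G B]
  {𝒞 : RelClone A} {h : A → B → Prop}

/-- The image of a binary relation under a partial map. -/
def imageRel (h : A → B → Prop) (E : A → A → Prop) (b b' : B) : Prop :=
  ∃ a a', h a b ∧ h a' b' ∧ E a a'

theorem FactorGraph.interp {E : A → A → Prop} (M : FactorGraph G 𝒞 E) (H : 𝒞.IsInterp h)
    (hG : ∀ (g : G) {a b}, h a b → h (g • a) (g • b))
    (havoid : ∀ {a a' b}, h a b → h a' b → ¬ Fac G E a a') :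
    FactorGraph G (𝒞.interp H) (imageRel h E) := by
  have hinv : Inv2 G (imageRel h E) := by
    rintro g b b' ⟨a, a', h1, h2, h3⟩
    exact ⟨_, _, hG g h1, hG g h2, M.inv g h3⟩
  refine ⟨fun b => ?_, ?_, hinv, ?_, ?_⟩
  · obtain ⟨a, ha⟩ := H.surj b
    rw [RelClone.interp_def1]
    refine RelClone.Def.congr (H.ker.image (M.orb a)) fun x => ?_
    constructor
    · rintro ⟨_, ⟨g, rfl⟩, c, h1, h2⟩
      exact ⟨c, h2, g, H.func (hG g ha) h1⟩
    · rintro ⟨c, h1, g, rfl⟩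
      exact ⟨_, ⟨g, rfl⟩, _, hG g ha, h1⟩
  · rw [RelClone.interp_def2]
    refine RelClone.Def.congr (H.ker.comp (M.edge.comp H.ker)) fun x => ?_
    constructor
    · rintro ⟨a, ⟨b, h1, h2⟩, a', h3, b', h4, h5⟩
      exact ⟨b, b', h1, h5, a, a', h2, h4, h3⟩
    · rintro ⟨b, b', h1, h5, a, a', h2, h4, h3⟩
      exact ⟨a, ⟨b, h1, h2⟩, a', h3, b', h4, h5⟩
  · rintro b b' ⟨g, a, a', h1, h2, h3⟩
    obtain ⟨k, hk⟩ := M.symm (Fac.of (G := G) h3)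
    exact (fac_smul_left hinv g).1 ⟨k, a', k • a, h2, hG k h1, hk⟩
  · rintro b ⟨g, a, a', h1, h2, h3⟩
    exact havoid h1 (by simpa using hG g⁻¹ h2) ((fac_smul_right _).2 (Fac.of h3))

theorem exists_coloring_of_imageRel {E : A → A → Prop} (H : 𝒞.IsInterp h)
    (hG : ∀ (g : G) {a b}, h a b → h (g • a) (g • b))
    (hS : ∃ S : Set B, ∀ b b', Fac G (imageRel h E) b b' → (b ∈ S ↔ b' ∉ S)) :
    ∃ S : Set A, ∀ a a', (∃ b, h a b) → (∃ b, h a' b) → Fac G E a a' → (a ∈ S ↔ a' ∉ S) := by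
  obtain ⟨S, hS⟩ := hS
  refine ⟨{a | ∃ b ∈ S, h a b}, ?_⟩
  rintro a a' ⟨b, hb⟩ ⟨b', hb'⟩ ⟨g, hg⟩
  have key := hS b b' ⟨g, a, g • a', hb, hG g hb', hg⟩
  have h1 : a ∈ {a | ∃ b ∈ S, h a b} ↔ b ∈ S :=
    ⟨fun ⟨c, hc, hac⟩ => H.func hac hb ▸ hc, fun hc => ⟨b, hc, hb⟩⟩
  have h2 : a' ∈ {a | ∃ b ∈ S, h a b} ↔ b' ∈ S :=
    ⟨fun ⟨c, hc, hac⟩ => H.func hac hb' ▸ hc, fun hc => ⟨b', hc, hb'⟩⟩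
  rw [h1, h2, key]

/-- Choosing preimages embeds the orbits of pairs over `B` into those over `A`. The embedding misses
the orbit of `(a, a)` when `a` is outside the domain, and cannot hit both `(a, a)` and `(a, a')`
when `a ≠ a'` have the same image. -/
theorem card_orbits_lt [Finite (MulAction.orbitRel.Quotient G (A × A))] (H : 𝒞.IsInterp h)
    (hG : ∀ (g : G) {a b}, h a b → h (g • a) (g • b))
    (hne : (∃ a, ∀ b, ¬ h a b) ∨ ∃ a a' b, a ≠ a' ∧ h a b ∧ h a' b) :
    Finite (MulAction.orbitRel.Quotient G (B × B)) ∧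
      Nat.card (MulAction.orbitRel.Quotient G (B × B)) <
        Nat.card (MulAction.orbitRel.Quotient G (A × A)) := by
  choose s hs using H.surj
  let φ : MulAction.orbitRel.Quotient G (B × B) → MulAction.orbitRel.Quotient G (A × A) :=
    fun q => Quotient.mk _ (s q.out.1, s q.out.2)
  have key : ∀ q a a', φ q = Quotient.mk _ (a, a') →
      ∃ b b', h a b ∧ h a' b' ∧ q = Quotient.mk _ (b, b') := by
    intro q a a' hq
    obtain ⟨g, hg⟩ := Quotient.exact hq.symm
    have h1 : g • s q.out.1 = a := congrArg Prod.fst hg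
    have h2 : g • s q.out.2 = a' := congrArg Prod.snd hg
    refine ⟨g • q.out.1, g • q.out.2, h1 ▸ hG g (hs _), h2 ▸ hG g (hs _), ?_⟩
    conv_lhs => rw [← q.out_eq]
    exact Quotient.sound ⟨g⁻¹, by simp⟩
  have hinj : Function.Injective φ := by
    intro q q' hqq
    obtain ⟨b, b', h1, h2, rfl⟩ := key q _ _ hqq
    rw [H.func h1 (hs _), H.func h2 (hs _)]
    exact q'.out_eq
  have hfin := Finite.of_injective φ hinj
  refine ⟨hfin, ?_⟩
  have := Fintype.ofFinite (MulAction.orbitRel.Quotient G (B × B))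
  have := Fintype.ofFinite (MulAction.orbitRel.Quotient G (A × A))
  rw [Nat.card_eq_fintype_card, Nat.card_eq_fintype_card]
  refine Fintype.card_lt_of_injective_not_surjective φ hinj fun hsurj => ?_
  rcases hne with ⟨a, ha⟩ | ⟨a, a', b, hne, h1, h2⟩
  · obtain ⟨q, hq⟩ := hsurj (Quotient.mk _ (a, a))
    obtain ⟨b, -, hb, -⟩ := key q _ _ hq
    exact ha b hb
  · obtain ⟨q, hq⟩ := hsurj (Quotient.mk _ (a, a))
    obtain ⟨q', hq'⟩ := hsurj (Quotient.mk _ (a, a'))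
    obtain ⟨c, c', k1, k2, e⟩ := key q _ _ hq
    obtain ⟨d, d', l1, l2, e'⟩ := key q' _ _ hq'
    obtain rfl := H.func k1 h1
    obtain rfl := H.func k2 k1
    obtain rfl := H.func l1 k1
    obtain rfl := H.func l2 h2
    obtain ⟨g, hg⟩ := Quotient.exact (hq.symm.trans (e.trans e'.symm ▸ hq'))
    have e1 : g • a = a := congrArg Prod.fst hg
    have e2 : g • a' = a := congrArg Prod.snd hg
    exact hne (MulAction.injective g (e1.trans e2.symm))

end Transfer

/-! ### Reduction to minimal graphs -/

section Core

variable {G : Type v} [Group G] {A : Type u} [MulAction G A]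

/-- The exponent is positive because the zeroth power is equality, for which `Fac` means lying in
the same orbit. -/
theorem fac_relPow {E : A → A → Prop} (hE : Inv2 G E) {n : ℕ} {a b : A} :
    Fac G (relPow E (n + 1)) a b ↔ relPow (Fac G E) (n + 1) a b := by
  have mono : ∀ {n a b}, relPow E n a b → relPow (Fac G E) n a b := by
    intro n
    induction n with
    | zero => exact id
    | succ n ih => exact fun ⟨c, h1, h2⟩ => ⟨c, ih h1, .of h2⟩
  constructor
  · rintro ⟨g, c, h1, h2⟩
    exact ⟨c, mono h1, g, h2⟩
  · rintro ⟨c, h1, k, h2⟩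
    cases n with
    | zero =>
      obtain rfl : a = c := h1
      exact ⟨k, a, rfl, h2⟩
    | succ n =>
      obtain ⟨g, hg⟩ := (fac_relPow hE).2 h1
      exact ⟨g * k, g • c, hg, by simpa [mul_smul] using hE g h2⟩

theorem exists_odd_closed_walk {A : Type u} {R : A → A → Prop} (hs : ∀ {a b}, R a b → R b a)
    (hi : ∀ {a}, ¬ R a a) (hc : ¬ ∃ S : Set A, ∀ a b, R a b → (a ∈ S ↔ b ∉ S)) :
    ∃ n a, Odd n ∧ relPow R n a a := by
  let Γ : SimpleGraph A := { Adj := R, symm := ⟨fun _ _ => hs⟩, loopless := ⟨fun _ => hi⟩ }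
  have walk : ∀ {a b} (w : Γ.Walk a b), relPow R w.length a b := by
    intro a b w
    induction w with
    | nil => rfl
    | cons h w ih =>
      rw [SimpleGraph.Walk.length_cons, add_comm, relPow_add]
      exact ⟨_, relPow_one.2 h, ih⟩
  by_contra! hno
  have hcol : Γ.Colorable 2 := SimpleGraph.two_colorable_iff_forall_loop_even.2 fun a w => by
    rw [← Nat.not_odd_iff_even]
    exact fun ho => hno _ a ho (walk w)
  obtain ⟨C⟩ := hcol
  refine hc ⟨{a | C a = 0}, fun a b hab => ?_⟩
  have : C a ≠ C b := C.valid hab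
  simp only [Set.mem_ofPred_eq]
  omega

/-- Some odd power of a non-bipartite factor graph is a factor graph with a triangle. -/
theorem FactorGraph.exists_tri {𝒞 : RelClone A} {E : A → A → Prop} (M : FactorGraph G 𝒞 E)
    (hc : ¬ ∃ S : Set A, ∀ a b, Fac G E a b → (a ∈ S ↔ b ∉ S)) :
    ∃ E', FactorGraph G 𝒞 E' ∧ ∃ a b c, Fac G E' a b ∧ Fac G E' b c ∧ Fac G E' a c := by
  classical
  have hex := exists_odd_closed_walk M.symm M.irrefl hc
  obtain ⟨a, hodd, hwalk⟩ := Nat.find_spec hex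
  have hmin : ∀ n < Nat.find hex, ∀ a, Odd n → ¬ relPow (Fac G E) n a a :=
    fun n hn a ho hw => Nat.find_min hex hn ⟨a, ho, hw⟩
  generalize Nat.find hex = k at hodd hwalk hmin
  obtain ⟨j, rfl⟩ := hodd
  rcases j with _ | j
  · exact absurd (relPow_one.1 hwalk) M.irrefl
  have hpad : ∀ {a b}, Fac G E a b → ∀ i, relPow (Fac G E) (2 * i + 1) a b := by
    intro a b hab i
    induction i with
    | zero => exact relPow_one.2 hab
    | succ i ih => exact ⟨a, ⟨b, ih, M.symm hab⟩, hab⟩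
  -- A shortest odd closed walk has length `2 * j + 3`, so this power has no loops. Its triangle
  -- consists of the first `2 * j + 1` steps of the walk and its last two edges, each padded by
  -- going back and forth.
  refine ⟨relPow E (2 * j + 1), ⟨M.orb, relPow_def M.edge _, relPow_inv M.inv _, ?_, ?_⟩, ?_⟩
  · intro a b h
    rw [fac_relPow M.inv] at h ⊢
    exact relPow_symm (fun _ _ => M.symm) h
  · intro a h
    rw [fac_relPow M.inv] at h
    exact hmin _ (by omega) a ⟨j, rfl⟩ h
  · obtain ⟨d, ⟨c, h1, h2⟩, h3⟩ := hwalk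
    refine ⟨a, c, d, ?_, ?_, ?_⟩ <;> rw [fac_relPow M.inv]
    exacts [h1, hpad h2 j, hpad (M.symm h3) j]

/-- A definable invariant digraph whose factor graph is symmetric, loopless and not 2-colourable
generates a hard clone. -/
theorem FactorGraph.hard [hfin : Finite (MulAction.orbitRel.Quotient G (A × A))] {𝒞 : RelClone A}
    {E : A → A → Prop} (M : FactorGraph G 𝒞 E)
    (hc : ¬ ∃ S : Set A, ∀ a b, Fac G E a b → (a ∈ S ↔ b ∉ S)) : 𝒞.Hard := by
  induction hn : Nat.card (MulAction.orbitRel.Quotient G (A × A)) using Nat.strong_induction_on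
    generalizing A with
  | _ n ih =>
  subst hn
  by_contra hhard
  obtain ⟨E', M', htri⟩ := M.exists_tri hc
  refine hhard (MinimalGraph.hard (G := G) (E := E') { M' with tri := htri, bip := ?_, quot := ?_ })
  · intro X hX hI hne
    by_contra hS
    let p : SubMulAction G A := ⟨X, fun g _ ha => hI g ha⟩
    have H : 𝒞.IsInterp fun (a : A) (b : p) => a = b := by
      have hdom : {a : A | ∃ b : p, a = b} = X := by
        ext a
        exact ⟨fun ⟨b, hb⟩ => hb ▸ b.2, fun ha => ⟨⟨a, ha⟩, rfl⟩⟩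
      refine ⟨fun h h' => Subtype.ext (h.symm.trans h'), fun b => ⟨b, rfl⟩, hdom ▸ hX, ?_⟩
      refine RelClone.Def.congr (RelClone.Def.and 𝒞.eq' (hX.app (α := Bool) false)) fun x => ?_
      constructor
      · rintro ⟨h, hx⟩
        exact ⟨⟨_, hx⟩, rfl, h.symm⟩
      · rintro ⟨b, h, h'⟩
        exact ⟨h.trans h'.symm, show x false ∈ X from h ▸ b.2⟩
    have hG : ∀ (g : G) {a : A} {b : p}, a = b → g • a = (g • b : p) := by
      rintro g _ b rfl
      rfl
    obtain ⟨a, ha⟩ := (Set.ne_univ_iff_exists_notMem X).1 hne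
    obtain ⟨hfin', hlt⟩ := card_orbits_lt H hG (Or.inl ⟨a, fun b hb => ha (hb ▸ b.2)⟩)
    refine hhard (RelClone.Hard.of_interp (H := H)
      (ih _ hlt (M'.interp H hG ?_) (fun h => hS ?_) rfl))
    · rintro a a' b rfl rfl
      exact M'.irrefl
    · obtain ⟨S, hS⟩ := exists_coloring_of_imageRel H hG h
      exact ⟨S, fun a ha b hb => hS a b ⟨⟨a, ha⟩, rfl⟩ ⟨⟨b, hb⟩, rfl⟩⟩
  · intro R hR hI heq havoid a b hab
    by_contra hne
    let s : Setoid A := ⟨R, heq⟩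
    let _ : MulAction G (Quotient s) :=
      { smul := fun g => Quotient.map (g • ·) fun _ _ h => hI g h
        one_smul := by
          rintro ⟨a⟩
          exact congrArg (Quotient.mk s) (one_smul G a)
        mul_smul := by
          rintro g k ⟨a⟩
          exact congrArg (Quotient.mk s) (mul_smul g k a) }
    have H : 𝒞.IsInterp fun (a : A) (q : Quotient s) => Quotient.mk s a = q := by
      refine ⟨fun h h' => h.symm.trans h', Quotient.exists_rep, ?_, ?_⟩
      · convert RelClone.def1_univ using 1
        exact Set.eq_univ_of_forall fun a => ⟨_, rfl⟩
      · refine RelClone.Def.congr hR fun x => ?_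
        constructor
        · intro h
          exact ⟨_, rfl, (Quotient.sound h).symm⟩
        · rintro ⟨q, h, h'⟩
          exact Quotient.exact (h.trans h'.symm)
    have hG : ∀ (g : G) {a : A} {q : Quotient s}, Quotient.mk s a = q →
        Quotient.mk s (g • a) = g • q := by
      rintro g a _ rfl
      rfl
    obtain ⟨hfin', hlt⟩ := card_orbits_lt H hG
      (Or.inr ⟨a, b, _, hne, rfl, (Quotient.sound hab).symm⟩)
    refine hhard (RelClone.Hard.of_interp (H := H)
      (ih _ hlt (M'.interp H hG ?_) (fun h => ?_) rfl))
    · rintro a a' b h h'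
      exact havoid a a' (Quotient.exact (h.trans h'.symm))
    · obtain ⟨S, hS⟩ := exists_coloring_of_imageRel H hG h
      obtain ⟨a, b, c, h1, h2, h3⟩ := htri
      have k1 := hS a b ⟨_, rfl⟩ ⟨_, rfl⟩ h1
      have k2 := hS b c ⟨_, rfl⟩ ⟨_, rfl⟩ h2
      have k3 := hS a c ⟨_, rfl⟩ ⟨_, rfl⟩ h3
      tauto

end Core

/-! ### From clones to pp-formulas and interpretations -/

namespace FirstOrder.Language

variable {L : Language.{u, v}}

theorem BoundedFormula.IsPP.relabel {α : Type w} {β : Type w₁} {m n : ℕ} {φ : L.BoundedFormula α n}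
    (h : φ.IsPP) (f : α → β ⊕ Fin m) : (φ.relabel f).IsPP := by
  induction h with
  | atomic h => exact .atomic (h.relabel f)
  | inf _ _ h₁ h₂ => exact .inf h₁ h₂
  | ex _ h =>
    rw [BoundedFormula.relabel_ex]
    exact .ex h

variable {A : Type w} [L.Structure A]

/-- The clone of relations that are primitive positive definable, provided all constants are. -/
def ppClone (L : Language.{u, v}) (A : Type w) [L.Structure A] [Nonempty A]
    (hconst : ∀ a : A, L.PPDefinable {x : Unit → A | x () = a}) : RelClone A where
  Def P := L.PPDefinable {x | P x}
  -- The index type may be empty, leaving no free variable for an equation, so truth is `∃ z, z = z`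
  -- and `A` must be nonempty.
  true' := ⟨BoundedFormula.ex (Term.bdEqual (Term.var (Sum.inr 0)) (Term.var (Sum.inr 0))),
    .ex (.atomic (.equal _ _)), fun x => by simp [Formula.Realize]⟩
  and' := by
    rintro α _ P Q ⟨φ, hφ, h⟩ ⟨ψ, hψ, h'⟩
    exact ⟨φ ⊓ ψ, .inf hφ hψ, fun x => by
      rw [Formula.realize_inf, h, h']
      rfl⟩
  reindex' := by
    rintro α β _ _ f P ⟨φ, hφ, h⟩
    exact ⟨φ.relabel f, hφ.relabel _, fun x => by
      rw [Formula.realize_relabel, h]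
      rfl⟩
  ex' := by
    rintro α _ P ⟨φ, hφ, h⟩
    let f : Option α → α ⊕ Fin 1 := fun o => o.elim (Sum.inr 0) Sum.inl
    refine ⟨BoundedFormula.ex (n := 0) (BoundedFormula.relabel (n := 1) (k := 0) f φ),
      .ex (hφ.relabel f), fun x => ?_⟩
    rw [Formula.Realize, BoundedFormula.realize_ex]
    refine exists_congr fun a => ?_
    refine (BoundedFormula.realize_relabel (m := 1) (n := 0)).trans ?_
    refine Iff.trans ?_ (h _)
    rw [Formula.Realize]
    refine iff_of_eq (congrArg₂ _ ?_ (Subsingleton.elim _ _))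
    funext o
    cases o <;> rfl
  eq' := ⟨Term.equal (Term.var false) (Term.var true), .atomic (.equal _ _), fun x => by
    simp [Formula.realize_equal]⟩
  const' := hconst

theorem ppInterprets_of_hard [Nonempty A]
    (hconst : ∀ a : A, L.PPDefinable {x : Unit → A | x () = a})
    (hhard : (ppClone L A hconst).Hard) (L' : Language.{u₁, v₁}) [L'.IsRelational] (B : Type w₁)
    [Finite B] [L'.Structure B] : L.PPInterprets A L' B := by
  classical
  obtain ⟨k, hfunc, hsurj, hdef⟩ := hhard
  obtain ⟨n, ⟨e⟩⟩ := Finite.exists_equiv_fin B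
  -- One-hot code of `b`. The extra last coordinate, always false, keeps the dimension positive even
  -- if `B` is empty.
  let code (b : B) (j : Fin (n + 1)) : Bool := decide (j = (e b).castSucc)
  have hcode : ∀ b b', code b = code b' → b = b' := by
    intro b b' h
    have := congrFun h (e b).castSucc
    simpa [code] using this
  let h : (Fin (n + 1) → A) →. B := fun x =>
    ⟨∃ b, ∀ j, k (x j) (code b j), fun H => H.choose⟩
  have mem_h : ∀ x b, b ∈ h x ↔ ∀ j, k (x j) (code b j) := by
    intro x b
    constructor
    · rintro ⟨H, rfl⟩
      exact H.choose_spec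
    · intro H
      refine ⟨⟨b, H⟩, hcode _ _ (funext fun j => ?_)⟩
      exact hfunc (Exists.choose_spec (⟨b, H⟩ : ∃ b, ∀ j, k (x j) (code b j)) j) (H j)
  have key : ∀ {m : ℕ} (R : Set (Fin m → B)), L.PPDefinable (blockPreimage h R) := by
    intro m R
    obtain ⟨φ, hφ, H⟩ := hdef fun y : Fin m × Fin (n + 1) → Bool =>
      ∃ b ∈ R, y = fun p => code (b p.1) p.2
    refine ⟨φ, hφ, fun x => (H x).trans ?_⟩
    constructor
    · rintro ⟨y, hy, b, hb, rfl⟩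
      exact ⟨b, hb, fun i => (mem_h _ _).2 fun j => hy (i, j)⟩
    · rintro ⟨b, hb, hx⟩
      exact ⟨_, fun p => (mem_h _ _).1 (hx p.1) p.2, b, hb, rfl⟩
  refine ⟨n + 1, by omega, h, fun b => ?_, key _, key _, fun m R => key _⟩
  choose s hs using hsurj
  exact ⟨fun j => s (code b j), (mem_h _ _).2 fun j => hs _⟩

end FirstOrder.Language

/-! ### Application to the orbit expansion -/

theorem theorem3 {A : Type u} (D : Digraph A) (hD : D.IsSmooth) (G : Subgroup D.Aut)
    (hG : Finite (MulAction.orbitRel.Quotient G (A × A)))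
    (hsymm : (D.factor G).IsSymmetric) (hloop : (D.factor G).IsLoopless)
    (hbip : ¬ (D.factor G).IsBipartite)
    (L : FirstOrder.Language.{u₁, v₁}) [L.IsRelational]
    (B : Type w₁) [Finite B] [L.Structure B] :
    letI := D.orbitExpansion G
    FirstOrder.Language.PPInterpretsWithParameters (D.orbitLanguage G) A L B := by
  let _ := D.orbitExpansion G
  let _ := FirstOrder.Language.unaryStructure fun a : A => ({a} : Set A)
  have hne : Nonempty A := by
    by_contra hA
    rw [not_nonempty_iff] at hA
    exact hbip ⟨∅, fun a => isEmptyElim a.out⟩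
  have rel1 : ∀ {X : Set A} (R : ((D.orbitLanguage G).sum
      (FirstOrder.Language.unaryLanguage A)).Relations 1),
      (∀ x : Fin 1 → A, FirstOrder.Language.Structure.RelMap R x ↔ x 0 ∈ X) →
      ((D.orbitLanguage G).sum (FirstOrder.Language.unaryLanguage A)).PPDefinable
        {x : Unit → A | x () ∈ X} := fun {X} R hR =>
    ⟨R.formula fun _ => .var (), .atomic (.rel _ _), fun x => by
      rw [FirstOrder.Language.Formula.realize_rel, hR]
      rfl⟩
  have hconst : ∀ a : A, ((D.orbitLanguage G).sum
      (FirstOrder.Language.unaryLanguage A)).PPDefinable {x : Unit → A | x () = a} := fun a =>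
    rel1 (X := {a}) (Sum.inr (.mk a)) fun _ => Iff.rfl
  have hfac : ∀ a b, Fac G D.Adj a b ↔ (D.factor G).Adj (Quotient.mk _ a) (Quotient.mk _ b) := by
    intro a b
    constructor
    · rintro ⟨g, h⟩
      exact ⟨a, g • b, MulAction.mem_orbit_self a, ⟨g, rfl⟩, h⟩
    · rintro ⟨_, _, ⟨g, rfl⟩, ⟨k, rfl⟩, h⟩
      refine ⟨g⁻¹ * k, ?_⟩
      have := ((g⁻¹ : G) : D.Aut).map_rel_iff.2 h
      rw [mul_smul]
      convert this using 1
      · exact (inv_smul_smul g a).symm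
      · rfl
  refine FirstOrder.Language.ppInterprets_of_hard hconst
    (FactorGraph.hard (G := G) (E := D.Adj) ⟨fun a => ?_, ?_, ?_, ?_, ?_⟩ ?_) L B
  · exact rel1 (Sum.inl (Sum.inr (.mk (Quotient.mk _ a)))) fun _ => Iff.rfl
  · exact ⟨FirstOrder.Language.Relations.formula (n := 2) (Sum.inl (Sum.inl .adj))
      ![.var false, .var true], .atomic (.rel _ _), fun x =>
      FirstOrder.Language.Formula.realize_rel⟩
  · exact fun g a b h => (g : D.Aut).map_rel_iff.2 h
  · intro a b
    rw [hfac, hfac]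
    exact hsymm _ _
  · intro a
    rw [hfac]
    exact hloop _
  · rintro ⟨S, hS⟩
    refine hbip ⟨{o | o.out ∈ S}, fun o o' h => hS _ _ ?_⟩
    rw [hfac, Quotient.out_eq, Quotient.out_eq]
    exact h
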